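/- **Theorem (GMM optimality).** Let $\mathcal X$ be a finite set, let $Q$ be a probability distribution on $\mathcal X$ with $Q(x)>0$ for all $x$, and let $X_1,X_2,\dots$ be i.i.d. from $Q$, with empirical type $P_n=n^{-1}\sum_{i\le n}\delta_{X_i}\in\mathbb R^{\mathcal X}$. Let $h:\mathcal X\to\mathbb R^d$, let $\Theta$ be a parameter set, and for $\theta\in\Theta$ let $\alpha(\theta)\in\mathbb R^d$ and $$E_\theta=\Big\{P\in\mathbb R^{\mathcal X}:\ P(x)>0\ \text{for all } x,\ \sum_xP(x)=1,\ \sum_xP(x)h(x)=\alpha(\theta)\Big\},$$ $$\mathsf T^*_\theta=\Big\{v\in\mathbb R^{\mathcal X}:\ \sum_xv(x)=0,\ \sum_xv(x)h(x)=0\Big\}.$$ Let $P^*_\theta$ be the information projection of $Q$ onto $E_\theta$, i.e. a minimizer of $\sum_xP(x)\log\frac{P(x)}{Q(x)}$ over $P\in E_\theta$ (assumed to exist). Let $V$ be a matrix whose columns form an orthonormal basis of $\mathsf T^*_\theta$ (this space does not depend on $\theta$), and let $$H^*_\theta=V^\top\mathrm{diag}(1/P^*_\theta)\,V$$ be the information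 metric on $\mathsf T^*_\theta$ in the coordinates $V$. Let $g:\mathcal X\times\Theta\to\mathbb R^q$ be a moment function, with sample moments $\bar g_n(\theta)=n^{-1}\sum_{i\le n}g(X_i,\theta)$ and moment map $A_\theta:\mathbb R^{\mathcal X}\to\mathbb R^q$, $A_\theta v=\sum_xv(x)g(x,\theta)$ (the derivative of $P\mapsto\mathbb E_P[g(X,\theta)]$); in the coordinates $V$ the restriction $A_\theta|_{\mathsf T^*_\theta}$ is the $q\times r$ matrix $A_\theta V$, where $r=\dim\mathsf T^*_\theta$. Assume that for every $\theta\in\Theta$: * $\mathbb E_{P^*_\theta}[g(X,\theta)]=0$; * $A_\theta$ maps $\mathsf T^*_\theta$ onto $\mathbb R^q$; * each of the subspaces $\mathsf T^*_\theta$ and $\mathsf T^*_\theta\cap\ker A_\theta$ is spanned by vectors with integer coordinates (as is the case when $h$ and $g(\cdot,\theta)-g(x_0,\theta)$, for a fixed $x_0\in\mathcal X$, take rational values). Define the conditional likelihood $\mathcal L_{\mathrm{cond}}(\theta)$ as the conditional probability, given $P_n\in E_\theta$, of the observed value of the sample moment, normalized to have maximal value one: $$\mathcal L_{\mathrm{cond}}(\theta)=\frac{L_n(\bar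 g_n(\theta))}{\sup_{\gamma\in\mathbb R^q}L_n(\gamma)},\qquad L_n(\gamma)=\Pr\big(\bar g_n(\theta)=\gamma\ \big|\ P_n\in E_\theta\big).$$ Then for every $\theta\in\Theta$ the matrices $H^*_\theta$ and $(A_\theta|_{\mathsf T^*_\theta})H_\theta^{*-1}(A_\theta|_{\mathsf T^*_\theta})^\top$ are positive definite; the matrix $$W^{\mathrm{opt}}_\theta=\Big[(A_\theta|_{\mathsf T^*_\theta})\,H_\theta^{*-1}\,(A_\theta|_{\mathsf T^*_\theta})^\top\Big]^{-1}$$ is the metric induced on moment space by the information metric through the moment map, i.e. for all $u\in\mathbb R^q$ $$u^\top W^{\mathrm{opt}}_\theta u=\min\Big\{\sum_x\frac{v(x)^2}{P^*_\theta(x)}:\ v\in\mathsf T^*_\theta,\ A_\theta v=u\Big\};$$ and $$-\log\mathcal L_{\mathrm{cond}}(\theta)=\frac n2\,\bar g_n(\theta)^\top W^{\mathrm{opt}}_\theta\,\bar g_n(\theta)+O_p(n^{-1/2}),$$ where $O_p$ refers to the conditional laws $\Pr(\,\cdot\mid P_n\in E_\theta)$, as $n\to\infty$ through those $n$ for which $\Pr(P_n\in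 E_\theta)>0$. -/

import Mathlib

open MeasureTheory ProbabilityTheory Matrix

noncomputable section

namespace ConstrainedGMM

variable {𝒳 : Type*} [Fintype 𝒳] [DecidableEq 𝒳] {Ω : Type*} {d q r : ℕ}

/-- The open probability simplex on the finite sample space `𝒳`, as a set of vectors. -/
def openSimplex (𝒳 : Type*) [Fintype 𝒳] : Set (𝒳 → ℝ) :=
  {P | (∀ x, 0 < P x) ∧ ∑ x, P x = 1}

/-- The moment map `P ↦ E_P[f(X)] = ∑ x, P(x) f(x)` of a vector-valued function `f`, as a linear
map on all of `ℝ^𝒳`.  Being linear, it is its own derivative at every `P`. -/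
def momentMap (f : 𝒳 → Fin q → ℝ) : (𝒳 → ℝ) →ₗ[ℝ] (Fin q → ℝ) :=
  (Matrix.of fun (j : Fin q) (x : 𝒳) => f x j).mulVecLin

/-- The constraint set `E = {P in the open simplex : E_P[h(X)] = α}`. -/
def constraintSet (h : 𝒳 → Fin d → ℝ) (α : Fin d → ℝ) : Set (𝒳 → ℝ) :=
  {P | P ∈ openSimplex 𝒳 ∧ momentMap h P = α}

/-- The Kullback–Leibler divergence on a finite space. -/
def klDivergence (P Q : 𝒳 → ℝ) : ℝ := ∑ x, P x * Real.log (P x / Q x)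

/-- `Pstar` is the information projection of `Q` onto `E`. -/
def IsInformationProjection (Q : 𝒳 → ℝ) (E : Set (𝒳 → ℝ)) (Pstar : 𝒳 → ℝ) : Prop :=
  Pstar ∈ E ∧ ∀ P ∈ E, klDivergence Pstar Q ≤ klDivergence P Q

/-- The tangent space `{v : ∑ x, v x = 0, A v = 0}` of the constraint set, where `A` is the matrix
with columns `h(x)`. -/
def tangentSpace (h : 𝒳 → Fin d → ℝ) : Submodule ℝ (𝒳 → ℝ) where
  carrier := {v | ∑ x, v x = 0 ∧ momentMap h v = 0}
  zero_mem' := by simp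
  add_mem' := by
    rintro v w ⟨hv, hv'⟩ ⟨hw, hw'⟩
    refine ⟨?_, ?_⟩
    · simp [Finset.sum_add_distrib, hv, hw]
    · rw [map_add, hv', hw', add_zero]
  smul_mem' := by
    rintro c v ⟨hv, hv'⟩
    refine ⟨?_, ?_⟩
    · simp [← Finset.mul_sum, hv]
    · rw [map_smul, hv', smul_zero]

/-- The columns of `V` form an orthonormal basis of `T` (Euclidean inner product). -/
def IsOrthonormalBasisOf (V : Matrix 𝒳 (Fin r) ℝ) (T : Submodule ℝ (𝒳 → ℝ)) : Prop :=
  Vᵀ * V = 1 ∧ LinearMap.range V.mulVecLin = T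

/-- The projected Hessian `H* = Vᵀ diag(1/P*) V`: the information metric at `P*` in the
orthonormal tangent coordinates `V`. -/
def projectedHessian (V : Matrix 𝒳 (Fin r) ℝ) (Pstar : 𝒳 → ℝ) : Matrix (Fin r) (Fin r) ℝ :=
  Vᵀ * Matrix.diagonal (fun x => 1 / Pstar x) * V

/-- The matrix of the moment map of `f` restricted to the tangent space, in the coordinates `V`. -/
def restrictedMoment (f : 𝒳 → Fin q → ℝ) (V : Matrix 𝒳 (Fin r) ℝ) : Matrix (Fin q) (Fin r) ℝ :=
  (Matrix.of fun (j : Fin q) (x : 𝒳) => f x j) * V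

/-- The pushforward `(A|_T) H*⁻¹ (A|_T)ᵀ` of the inverse metric tensor through the moment map. -/
def pushforwardMetric (f : 𝒳 → Fin q → ℝ) (V : Matrix 𝒳 (Fin r) ℝ) (Pstar : 𝒳 → ℝ) :
    Matrix (Fin q) (Fin q) ℝ :=
  restrictedMoment f V * (projectedHessian V Pstar)⁻¹ * (restrictedMoment f V)ᵀ

/-- The weight `W = [(A|_T) H*⁻¹ (A|_T)ᵀ]⁻¹`. -/
def optimalWeight (f : 𝒳 → Fin q → ℝ) (V : Matrix 𝒳 (Fin r) ℝ) (Pstar : 𝒳 → ℝ) :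
    Matrix (Fin q) (Fin q) ℝ :=
  (pushforwardMetric f V Pstar)⁻¹

/-- A linear subspace of `ℝ^𝒳` that is spanned by its vectors with integer coordinates. -/
def SpannedByIntegerVectors (S : Submodule ℝ (𝒳 → ℝ)) : Prop :=
  Submodule.span ℝ {v : 𝒳 → ℝ | v ∈ S ∧ ∀ x, ∃ z : ℤ, v x = z} = S

/-- The empirical type `P_n = n⁻¹ ∑_{i < n} δ_{X_i}`, as a vector of frequencies. -/
def empiricalType (X : ℕ → Ω → 𝒳) (n : ℕ) (ω : Ω) : 𝒳 → ℝ :=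
  fun x => (n : ℝ)⁻¹ * ∑ i ∈ Finset.range n, if X i ω = x then 1 else 0

/-- The sample moment `n⁻¹ ∑_{i < n} f(X_i)`. -/
def sampleMoment (X : ℕ → Ω → 𝒳) (f : 𝒳 → Fin q → ℝ) (n : ℕ) (ω : Ω) : Fin q → ℝ :=
  (n : ℝ)⁻¹ • ∑ i ∈ Finset.range n, f (X i ω)

variable [MeasurableSpace Ω]

/-- The conditional law `Pr(· | P_n ∈ E)` of the experiment given that the empirical type of the
first `n` observations satisfies the constraint (the zero measure if this has probability zero). -/
def condLaw (μ : Measure Ω) (X : ℕ → Ω → 𝒳) (E : Set (𝒳 → ℝ)) (n : ℕ) : Measure Ω :=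
  ProbabilityTheory.cond μ {ω | empiricalType X n ω ∈ E}

/-- The conditional probability mass function `γ ↦ Pr(n⁻¹ ∑_{i < n} f(X_i) = γ | P_n ∈ E)` of the
sample moment. -/
def condMomentPMF (μ : Measure Ω) (X : ℕ → Ω → 𝒳) (E : Set (𝒳 → ℝ)) (f : 𝒳 → Fin q → ℝ)
    (n : ℕ) (γ : Fin q → ℝ) : ℝ :=
  (condLaw μ X E n).real {ω | sampleMoment X f n ω = γ}

/-- The conditional likelihood: the conditional probability, given `P_n ∈ E`, of the sample moment
that was observed, normalized (as a likelihood is only defined up to a factor that does not depend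
on the data) so that its largest possible value is one. -/
def condLikelihood (μ : Measure Ω) (X : ℕ → Ω → 𝒳) (E : Set (𝒳 → ℝ)) (f : 𝒳 → Fin q → ℝ)
    (n : ℕ) (ω : Ω) : ℝ :=
  condMomentPMF μ X E f n (sampleMoment X f n ω) / ⨆ γ : Fin q → ℝ, condMomentPMF μ X E f n γ

/-- `R_n = O_p(a_n)` under the sequence of laws `ν_n`. -/
def IsBigOInProbability (ν : ℕ → Measure Ω) (R : ℕ → Ω → ℝ) (a : ℕ → ℝ) : Prop :=
  ∀ ε : ℝ, 0 < ε → ∃ C : ℝ, ∃ N : ℕ, ∀ n : ℕ, N ≤ n →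
    (ν n) {ω | C * a n < |R n ω|} ≤ ENNReal.ofReal ε

end ConstrainedGMM

end

noncomputable section

namespace ConstrainedGMM

section

open Filter Topology

/-! ### Stirling's formula with an explicit error -/

/-! The conditional law of the sample moment satisfies a local limit theorem whose Gaussian exponent
is the quotient of the information metric under the moment map.

Since `P*` minimizes the divergence in a relatively open set, `log (P*/Q)` is orthogonal to the
tangent space `T` (`sum_mul_log_eq_zero`). The likelihood ratio of `Q` to `P*` is therefore constant
on the event `P_n ∈ E`, and given that event the counts may as well be drawn from `P*`
(`exists_measure_counts_eq`). Up to a factor depending on `n` only, the multinomial weight is a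
product of Poisson weights. Stirling's formula with explicit error turns the product into a Gaussian
of the scaled deviation, with an error `O(n^{-1/2})` that still has Gaussian decay
(`countWeight_sub_gaussian_le`), so it can be summed over an infinite lattice.

Given `P_n ∈ E`, fixing the sample moment means fixing the coset of the counts modulo the integer
vectors of `S = T ∩ ker A`. Dividing coordinates by `√P*` and splitting the scaled deviation as `m +
s`, with `s` in the image of `S` and `m` orthogonal to it, takes a factor `exp (-‖m‖²/2)` out of the
sum. What remains is a Riemann sum of mesh `n^{-1/2}`, equal to `n^{dim S / 2} (I + O(n^{-1/2}))`
uniformly in the shift, because the integer vectors of `S` form a full lattice. Hence `L_n(γ) = A_n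
(I exp (-‖m‖²/2) + O(n^{-1/2}))` with `A_n` independent of `γ` (`condMomentPMF_sub_gaussian_le`).

Because `T` too is spanned by integer vectors, some coset passes within bounded distance of `n P*`,
so the supremum of `L_n` is `A_n (I + O(n^{-1/2}))`, and `A_n` cancels in the likelihood. The tail
bound `condLaw_tail_le` keeps `‖m‖` bounded in conditional probability, so the additive errors
survive the logarithm. Finally `‖m‖²` and `n ḡᵀ W ḡ` are both the minimum of `∑ v²/P*` over the
tangent lifts of `√n ḡ` (`isLeast_norm_sq_of_orthogonal`, `isLeast_optimalWeight`), so they agree.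
-/

theorem log_sqrt_pi_le_log_stirlingSeq {k : ℕ} (hk : k ≠ 0) :
    Real.log (√Real.pi) ≤ Real.log (Stirling.stirlingSeq k) :=
  Real.log_le_log (by positivity) (Stirling.sqrt_pi_le_stirlingSeq hk)

/-- The successive decrements are at most `1/(12 m (m+1))`, which telescopes: subtracting `1/(12 m)`
makes the sequence increasing, and its limit is `log √π`. -/
theorem log_stirlingSeq_le {k : ℕ} (hk : k ≠ 0) :
    Real.log (Stirling.stirlingSeq k) ≤ Real.log (√Real.pi) + 1 / (12 * k) := by
  obtain ⟨j, rfl⟩ := Nat.exists_eq_succ_of_ne_zero hk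
  have hmono : Monotone fun m : ℕ =>
      Real.log (Stirling.stirlingSeq (m + 1)) - 1 / (12 * ((m : ℝ) + 1)) := by
    refine monotone_nat_of_le_succ fun m => ?_
    have h1 := Stirling.log_stirlingSeq_sdiff_le (m + 1)
    have h2 : (1 : ℝ) / (12 * ((m + 1 : ℕ) : ℝ) * (((m + 1 : ℕ) : ℝ) + 1)) =
        1 / (12 * ((m : ℝ) + 1)) - 1 / (12 * (((m + 1 : ℕ) : ℝ) + 1)) := by
      push_cast
      field_simp
      ring
    linarith
  have hlim : Tendsto (fun m : ℕ =>
      Real.log (Stirling.stirlingSeq (m + 1)) - 1 / (12 * ((m : ℝ) + 1))) atTop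
      (𝓝 (Real.log (√Real.pi) - 0)) := by
    refine Tendsto.sub ?_ ?_
    · exact ((Real.continuousAt_log (by positivity)).tendsto.comp
        Stirling.tendsto_stirlingSeq_sqrt_pi).comp (tendsto_add_atTop_nat 1)
    · have := (tendsto_one_div_add_atTop_nhds_zero_nat (𝕜 := ℝ)).const_mul (1 / 12)
      rw [mul_zero] at this
      refine this.congr fun m => ?_
      field_simp
  have := hmono.ge_of_tendsto hlim j
  simp only [Nat.succ_eq_add_one, Nat.cast_add, Nat.cast_one] at this ⊢
  linarith

/-! ### The local limit theorem for Poisson weights -/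

/-- The Poisson weight at `k`, normalized by the size of the Gaussian density at its peak. -/
def poissonTerm (l : ℝ) (k : ℕ) : ℝ :=
  √(2 * Real.pi * l) * Real.exp (-l) * l ^ k / k.factorial

theorem poissonTerm_pos {l : ℝ} (hl : 0 < l) (k : ℕ) : 0 < poissonTerm l k := by
  unfold poissonTerm; positivity

/-- Separates the Gaussian exponent from the corrections: near `y = k/l = 1` the middle term is `l
(y - 1)²/2` up to a cubic error, while the first and the last are the small corrections from the
variance and from Stirling's formula. -/
theorem log_poissonTerm {l : ℝ} (hl : 0 < l) {k : ℕ} (hk : k ≠ 0) :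
    Real.log (poissonTerm l k) = -(1 / 2) * Real.log (k / l)
      - l * (k / l * Real.log (k / l) - k / l + 1)
      - (Real.log (Stirling.stirlingSeq k) - Real.log (√Real.pi)) := by
  have hk' : (0 : ℝ) < k := by positivity
  have h1 := Stirling.log_stirlingSeq_formula k
  have hpi := Real.pi_pos
  rw [Real.log_div hk'.ne' (Real.exp_pos 1).ne', Real.log_exp,
    Real.log_mul two_ne_zero hk'.ne'] at h1
  unfold poissonTerm
  rw [Real.log_div (by positivity) (by positivity), Real.log_mul (by positivity) (by positivity),
    Real.log_mul (by positivity) (by positivity), Real.log_exp, Real.log_pow, Real.log_sqrt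
    (by positivity), Real.log_mul (by positivity) hl.ne', Real.log_mul two_ne_zero hpi.ne',
    Real.log_sqrt hpi.le, Real.log_div hk'.ne' hl.ne']
  have h2 : l * (k / l * (Real.log k - Real.log l) - k / l + 1) =
      k * (Real.log k - Real.log l) - k + l := by
    field_simp
  rw [h2]
  linarith

/-- The Hellinger bound `(√y - 1)² ≤ y log y - y + 1`, obtained from `log (1/√y) ≤ 1/√y - 1`,
combined with `y - 1 = (√y - 1)(√y + 1)`. It yields Gaussian decay on the whole range `y ≤ M`,
beyond the reach of the Taylor expansion. -/
theorem sq_sub_one_div_le_mul_log {y M : ℝ} (hy : 0 < y) (hM : y ≤ M) :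
    (y - 1) ^ 2 / (√M + 1) ^ 2 ≤ y * Real.log y - y + 1 := by
  have hs : 0 < √y := Real.sqrt_pos.2 hy
  have hyy : √y ^ 2 = y := Real.sq_sqrt hy.le
  have h1 : Real.log (1 / √y) ≤ 1 / √y - 1 := Real.log_le_sub_one_of_pos (by positivity)
  rw [one_div, Real.log_inv, Real.log_sqrt hy.le] at h1
  have h2 : y * (√y)⁻¹ = √y := by
    rw [← hyy]; field_simp; rw [Real.sqrt_sq hs.le]
  have h3 : (√y - 1) ^ 2 ≤ y * Real.log y - y + 1 := by
    have := mul_le_mul_of_nonneg_left h1 hy.le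
    nlinarith
  refine le_trans ?_ h3
  rw [div_le_iff₀ (by positivity)]
  have h4 : (y - 1) ^ 2 = (√y - 1) ^ 2 * (√y + 1) ^ 2 := by
    rw [← mul_pow]; congr 1; nlinarith
  rw [h4]
  gcongr

theorem abs_log_le_two_mul {d : ℝ} (hd : |d| ≤ 1 / 2) : |Real.log (1 + d)| ≤ 2 * |d| := by
  have := Real.abs_log_sub_add_sum_range_le (x := -d) (by rw [abs_neg]; linarith) 0
  simp only [Finset.range_zero, Finset.sum_empty, zero_add, sub_neg_eq_add, abs_neg, pow_one] at this
  refine this.trans ?_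
  rw [div_le_iff₀ (by linarith)]
  nlinarith [abs_nonneg d]

theorem abs_mul_log_sub_le {d : ℝ} (hd : |d| ≤ 1 / 2) :
    |(1 + d) * Real.log (1 + d) - (1 + d) + 1 - d ^ 2 / 2| ≤ 4 * |d| ^ 3 := by
  have := Real.abs_log_sub_add_sum_range_le (x := -d) (by rw [abs_neg]; linarith) 2
  simp only [Finset.sum_range_succ, Finset.range_zero, Finset.sum_empty, zero_add, sub_neg_eq_add,
    abs_neg, pow_one, Nat.cast_zero, Nat.cast_one, div_one] at this
  have h1 : |d| ^ 3 / (1 - |d|) ≤ 2 * |d| ^ 3 := by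
    rw [div_le_iff₀ (by linarith)]
    have : 0 ≤ |d| ^ 3 := by positivity
    nlinarith
  have h2 := this.trans h1
  set e := -d + (-d) ^ (1 + 1) / (1 + 1) + Real.log (1 + d) with he
  have h3 : (1 + d) * Real.log (1 + d) - (1 + d) + 1 - d ^ 2 / 2 = -(d ^ 3 / 2) + (1 + d) * e := by
    rw [he]; ring
  rw [h3]
  refine (abs_add_le _ _).trans ?_
  rw [abs_neg, abs_div, abs_pow, abs_mul, abs_two]
  have h4 : |1 + d| ≤ 3 / 2 := (abs_add_le _ _).trans (by rw [abs_one]; linarith)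
  have h5 : |1 + d| * |e| ≤ 3 / 2 * (2 * |d| ^ 3) := by gcongr
  have : 0 ≤ |d| ^ 3 := by positivity
  linarith

theorem abs_exp_sub_exp_le (s t : ℝ) :
    |Real.exp s - Real.exp t| ≤ |s - t| * (Real.exp s + Real.exp t) := by
  wlog h : t ≤ s generalizing s t
  · rw [abs_sub_comm, abs_sub_comm s, add_comm]
    exact this t s (le_of_not_ge h)
  rw [abs_of_nonneg (sub_nonneg.2 (Real.exp_le_exp.2 h)), abs_of_nonneg (sub_nonneg.2 h)]
  have h1 := Real.add_one_le_exp (t - s)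
  have h2 : Real.exp t = Real.exp s * Real.exp (t - s) := by rw [← Real.exp_add]; ring_nf
  have h3 : Real.exp s * (t - s + 1) ≤ Real.exp t := by
    rw [h2]; gcongr
  have : 0 ≤ (s - t) * Real.exp t := mul_nonneg (sub_nonneg.2 h) (Real.exp_pos _).le
  nlinarith

theorem mul_exp_neg_le {c t : ℝ} (hc : 0 < c) : t * Real.exp (-(c * t)) ≤ 1 / c := by
  rw [Real.exp_neg, ← div_eq_mul_inv, div_le_div_iff₀ (Real.exp_pos _) hc]
  linarith [Real.add_one_le_exp (c * t)]

/-- Absorbs the polynomial factors of Taylor errors into part of the Gaussian decay. Everything is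
dominated by `1 + |z|⁴`, which the quadratic lower bound for `exp` controls. -/
theorem poly_mul_exp_neg_le {c K z : ℝ} (hc : 0 < c) (hK : 0 ≤ K) :
    (|z| + 4 * |z| ^ 3 + K) * Real.exp (-(c * z ^ 2)) ≤ (5 + K) * (1 + 2 / c ^ 2) := by
  have h1 := Real.quadratic_le_exp_of_nonneg (x := c * z ^ 2) (by positivity)
  rw [Real.exp_neg, ← div_eq_mul_inv, div_le_iff₀ (Real.exp_pos _)]
  have h0 := abs_nonneg z
  have h2 : |z| ≤ 1 + |z| ^ 4 := by nlinarith [sq_nonneg (|z| - 1), sq_nonneg (|z| ^ 2 - 1)]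
  have h3 : |z| ^ 3 ≤ 1 + |z| ^ 4 := by
    nlinarith [sq_nonneg (|z| - 1), sq_nonneg (|z| ^ 2 - 1), sq_nonneg (|z| ^ 2 - |z|)]
  have h4 : |z| ^ 4 = (z ^ 2) ^ 2 := by rw [← sq_abs z]; ring
  have h5 : 1 + |z| ^ 4 ≤ (1 + 2 / c ^ 2) * Real.exp (c * z ^ 2) := by
    have h6 : |z| ^ 4 ≤ 2 / c ^ 2 * Real.exp (c * z ^ 2) := by
      rw [h4, div_mul_eq_mul_div, le_div_iff₀ (by positivity)]
      nlinarith [mul_nonneg hc.le (sq_nonneg z)]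
    have h7 : 1 ≤ Real.exp (c * z ^ 2) := by rw [Real.one_le_exp_iff]; positivity
    linarith
  calc |z| + 4 * |z| ^ 3 + K ≤ (5 + K) * (1 + |z| ^ 4) := by
        nlinarith [mul_nonneg hK (pow_nonneg h0 4)]
    _ ≤ (5 + K) * ((1 + 2 / c ^ 2) * Real.exp (c * z ^ 2)) := by gcongr
    _ = _ := by ring

set_option maxHeartbeats 800000 in
-- The Gaussian factor in the error is what makes it summable later. For `|k/l - 1| ≤ 1/2` Taylor
-- expansion applies; otherwise `z² ≥ l/4` and both terms are separately negligible. The bound `k ≤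
-- M l` costs nothing for counts, where `k ≤ n` and `l = n P(x)`.
theorem poissonTerm_sub_gaussian_le {M l₀ : ℝ} (hM : 1 ≤ M) (hl₀ : 0 < l₀) :
    ∃ C : ℝ, 0 ≤ C ∧ ∃ c : ℝ, 0 < c ∧ c ≤ 1 / 2 ∧ ∀ (l : ℝ) (k : ℕ), l₀ ≤ l → k ≠ 0 → k ≤ M * l →
      |poissonTerm l k - Real.exp (-(((k - l) / √l) ^ 2 / 2))| ≤
        C / √l * Real.exp (-(c * ((k - l) / √l) ^ 2)) := by
  -- Both terms decay at rate `c₀`; half of it is kept as `c`, the other half pays for polynomial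
  -- factors and powers of `l`.
  set c₀ : ℝ := 1 / (√M + 1) ^ 2 with hc₀
  have hsM : 1 ≤ √M := Real.one_le_sqrt.2 hM
  have hc₀pos : 0 < c₀ := by positivity
  have hc₀le : c₀ ≤ 1 / 4 := by
    rw [hc₀]; apply one_div_le_one_div_of_le <;> nlinarith
  set c := c₀ / 2 with hc
  have hcpos : 0 < c := by positivity
  set K : ℝ := 1 / √l₀ with hK
  have hs₀ : 0 < √l₀ := Real.sqrt_pos.2 hl₀
  set C₁ : ℝ := 3 * ((5 + K) * (1 + 2 / c ^ 2)) with hC₁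
  set C₂ : ℝ := 4 * (1 / c) * (1 + K) with hC₂
  have hKpos : 0 < K := by positivity
  refine ⟨max C₁ C₂, by positivity, c, hcpos, by linarith, ?_⟩
  intro l k hl hk hkM
  have hlpos : 0 < l := hl₀.trans_le hl
  have hs : 0 < √l := Real.sqrt_pos.2 hlpos
  have hss : √l ^ 2 = l := Real.sq_sqrt hlpos.le
  have hk1 : (1 : ℝ) ≤ k := by exact_mod_cast Nat.one_le_iff_ne_zero.2 hk
  set z := ((k : ℝ) - l) / √l with hz
  set d := (k : ℝ) / l - 1 with hd
  have hy : (k : ℝ) / l = 1 + d := by rw [hd]; ring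
  have hypos : 0 < (k : ℝ) / l := by positivity
  have hzd : z = d * √l := by
    rw [hz, hd]; field_simp; rw [hss]; ring
  have hz2 : z ^ 2 = l * d ^ 2 := by rw [hzd, mul_pow, hss]; ring
  have hphi : c₀ * z ^ 2 ≤ l * (k / l * Real.log (k / l) - k / l + 1) := by
    have h := sq_sub_one_div_le_mul_log hypos (div_le_of_le_mul₀ hlpos.le (by linarith) hkM)
    have := mul_le_mul_of_nonneg_left h hlpos.le
    refine le_trans (le_of_eq ?_) this
    rw [hz2, hc₀, ← hd]; ring
  have hrho0 := log_sqrt_pi_le_log_stirlingSeq hk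
  have hrho1 := log_stirlingSeq_le hk
  have hL := log_poissonTerm hlpos hk
  set L := Real.log (poissonTerm l k) with hLdef
  have hexpL : poissonTerm l k = Real.exp L := (Real.exp_log (poissonTerm_pos hlpos k)).symm
  have hgauss : Real.exp (-(z ^ 2 / 2)) ≤ Real.exp (-(c₀ * z ^ 2)) := by
    apply Real.exp_le_exp.2; nlinarith [sq_nonneg z]
  have hsplit : Real.exp (-(c₀ * z ^ 2)) = Real.exp (-(c * z ^ 2)) * Real.exp (-(c * z ^ 2)) := by
    rw [← Real.exp_add, hc]; ring_nf
  have he := Real.exp_pos (-(c * z ^ 2))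
  rw [hexpL]
  rcases le_or_gt |d| (1 / 2) with hnear | hfar
  · have hlog := abs_log_le_two_mul hnear
    have hmul := abs_mul_log_sub_le hnear
    rw [← hy] at hlog hmul
    have hdz : |d| = |z| / √l := by
      rw [hzd, abs_mul, abs_of_pos hs]; field_simp
    have hd3 : l * |d| ^ 3 = |z| ^ 3 / √l := by
      rw [hdz]; field_simp; rw [hss, mul_comm]
    have hkl : l / 2 ≤ k := by
      have h1 := (abs_le.1 hnear).1
      have : (1 / 2 : ℝ) ≤ k / l := by rw [hy]; linarith
      rw [le_div_iff₀ hlpos] at this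
      linarith
    have hkinv : 1 / (12 * (k : ℝ)) ≤ K / √l := by
      have h2 : √l₀ ≤ √l := Real.sqrt_le_sqrt hl
      rw [hK, div_div, div_le_div_iff₀ (by positivity) (by positivity)]
      nlinarith
    have hdist : |L - -(z ^ 2 / 2)| ≤ (|z| + 4 * |z| ^ 3 + K) / √l := by
      have : L - -(z ^ 2 / 2) = -(1 / 2) * Real.log (k / l) +
          -(l * (k / l * Real.log (k / l) - k / l + 1 - d ^ 2 / 2)) +
          -(Real.log (Stirling.stirlingSeq k) - Real.log (√Real.pi)) := by
        rw [hL, hz2]; ring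
      rw [this]
      refine (abs_add_three _ _ _).trans ?_
      rw [abs_neg, abs_neg, abs_mul, abs_mul l, abs_of_pos hlpos, abs_of_nonneg (sub_nonneg.2 hrho0),
        abs_neg, abs_of_pos (by norm_num : (0 : ℝ) < 1 / 2)]
      have h5 := mul_le_mul_of_nonneg_left hmul hlpos.le
      have h6 : (|z| + 4 * |z| ^ 3 + K) / √l = |d| + 4 * (l * |d| ^ 3) + K / √l := by
        rw [hd3, hdz]; ring
      rw [h6]
      linarith
    -- Here `(k/l)^{-1/2} ≤ exp (1/2) < 2`, and the Stirling remainder only lowers the weight.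
    have hexp : Real.exp L ≤ 2 * Real.exp (-(c₀ * z ^ 2)) := by
      have h7 : L ≤ Real.log 2 + -(c₀ * z ^ 2) := by
        have h8 : -(1 / 2) * Real.log (k / l) ≤ 1 / 2 := by
          have := (abs_le.1 hlog).1
          linarith
        have := Real.log_two_gt_d9
        linarith
      calc Real.exp L ≤ Real.exp (Real.log 2 + -(c₀ * z ^ 2)) := Real.exp_le_exp.2 h7
        _ = _ := by rw [Real.exp_add, Real.exp_log two_pos]
    calc |Real.exp L - Real.exp (-(z ^ 2 / 2))|
        ≤ |L - -(z ^ 2 / 2)| * (Real.exp L + Real.exp (-(z ^ 2 / 2))) := abs_exp_sub_exp_le _ _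
      _ ≤ (|z| + 4 * |z| ^ 3 + K) / √l * (3 * Real.exp (-(c₀ * z ^ 2))) := by
          gcongr; linarith
      _ = (3 * ((|z| + 4 * |z| ^ 3 + K) * Real.exp (-(c * z ^ 2)))) / √l *
            Real.exp (-(c * z ^ 2)) := by rw [hsplit]; ring
      _ ≤ C₁ / √l * Real.exp (-(c * z ^ 2)) := by
          have := poly_mul_exp_neg_le (z := z) hcpos hKpos.le
          gcongr
          exact mul_le_mul_of_nonneg_left this (by norm_num)
      _ ≤ _ := by
          gcongr
          exact le_max_left _ _
  -- Far regime: `l exp (-c z²)` is bounded, which supplies the missing factor `1/√l`.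
  · have hz4 : l ≤ 4 * z ^ 2 := by
      have : (1 / 2 : ℝ) ^ 2 ≤ |d| ^ 2 := by gcongr
      rw [sq_abs] at this
      rw [hz2]; nlinarith
    have hle : l * Real.exp (-(c * z ^ 2)) ≤ 4 * (1 / c) := by
      have := mul_exp_neg_le (t := z ^ 2) hcpos
      nlinarith
    -- The prefactor `(k/l)^{-1/2}` is at most `√l` because `k ≥ 1`.
    have hexp : Real.exp L ≤ √l * Real.exp (-(c₀ * z ^ 2)) := by
      have h7 : L ≤ Real.log (√l) + -(c₀ * z ^ 2) := by
        rw [Real.log_sqrt hlpos.le]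
        have h8 : -Real.log l ≤ Real.log (k / l) := by
          rw [Real.log_div (by positivity) hlpos.ne']
          linarith [Real.log_nonneg hk1]
        linarith
      calc Real.exp L ≤ Real.exp (Real.log (√l) + -(c₀ * z ^ 2)) := Real.exp_le_exp.2 h7
        _ = _ := by rw [Real.exp_add, Real.exp_log hs]
    have hg : Real.exp (-(z ^ 2 / 2)) ≤ K * √l * Real.exp (-(c₀ * z ^ 2)) := by
      have h2 : 1 ≤ K * √l := by
        rw [hK, one_div, ← div_eq_inv_mul, one_le_div hs₀]; exact Real.sqrt_le_sqrt hl
      refine hgauss.trans (le_mul_of_one_le_left (Real.exp_pos _).le h2)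
    calc |Real.exp L - Real.exp (-(z ^ 2 / 2))|
        ≤ Real.exp L + Real.exp (-(z ^ 2 / 2)) := by
          rw [abs_le]; constructor <;> linarith [Real.exp_pos L, Real.exp_pos (-(z ^ 2 / 2))]
      _ ≤ √l * Real.exp (-(c₀ * z ^ 2)) + K * √l * Real.exp (-(c₀ * z ^ 2)) := add_le_add hexp hg
      _ = (l * Real.exp (-(c * z ^ 2))) * (1 + K) / √l * Real.exp (-(c * z ^ 2)) := by
          rw [hsplit]; field_simp; rw [hss]
      _ ≤ C₂ / √l * Real.exp (-(c * z ^ 2)) := by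
          rw [hC₂]; gcongr
      _ ≤ _ := by
          gcongr
          exact le_max_right _ _

end

section

/-! ### The local limit theorem for products of Poisson weights -/

theorem abs_prod_le_of_le {ι : Type*} (s : Finset ι) {a b e : ι → ℝ} {η κ : ℝ} (hη : η ≤ κ)
    (he : ∀ i, 0 ≤ e i) (hb : ∀ i, |b i| ≤ e i) (hab : ∀ i, |a i - b i| ≤ η * e i) :
    |∏ i ∈ s, a i| ≤ (1 + κ) ^ s.card * ∏ i ∈ s, e i := by
  rw [Finset.abs_prod, ← Finset.prod_const, ← Finset.prod_mul_distrib]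
  refine Finset.prod_le_prod (fun _ _ => abs_nonneg _) fun i _ => ?_
  have h1 : |a i| ≤ |b i| + |a i - b i| := by
    have := abs_add_le (b i) (a i - b i)
    rwa [add_sub_cancel] at this
  nlinarith [hb i, hab i, he i]

/-- Factors are exchanged one at a time. The bound stays linear in `η`, with `κ` only a crude
ceiling for it, and keeps the full product of the envelopes `e i`, hence the joint Gaussian decay.
-/
theorem abs_prod_sub_prod_le {ι : Type*} (s : Finset ι) {a b e : ι → ℝ} {η κ : ℝ} (hη₀ : 0 ≤ η)
    (hη : η ≤ κ) (he : ∀ i, 0 ≤ e i) (hb : ∀ i, |b i| ≤ e i) (hab : ∀ i, |a i - b i| ≤ η * e i) :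
    |∏ i ∈ s, a i - ∏ i ∈ s, b i| ≤ η * (s.card * (1 + κ) ^ s.card * ∏ i ∈ s, e i) := by
  classical
  have hκ := hη₀.trans hη
  induction s using Finset.induction_on with
  | empty => simp
  | insert i s his ih =>
    rw [Finset.prod_insert his, Finset.prod_insert his, Finset.prod_insert his,
      Finset.card_insert_of_notMem his]
    have hA := abs_prod_le_of_le s hη he hb hab
    have hE : 0 ≤ ∏ i ∈ s, e i := Finset.prod_nonneg fun i _ => he i
    set A := ∏ i ∈ s, a i
    set B := ∏ i ∈ s, b i
    set E := ∏ i ∈ s, e i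
    set m : ℝ := (s.card : ℝ)
    set p := (1 + κ) ^ s.card with hp
    have hp0 : 0 ≤ p := by positivity
    have h1 : a i * A - b i * B = (a i - b i) * A + b i * (A - B) := by ring
    rw [h1]
    refine (abs_add_le _ _).trans ?_
    rw [abs_mul, abs_mul]
    have h2 : |a i - b i| * |A| ≤ η * e i * (p * E) :=
      mul_le_mul (hab i) hA (abs_nonneg _) (mul_nonneg hη₀ (he i))
    have h3 : |b i| * |A - B| ≤ e i * (η * (m * p * E)) :=
      mul_le_mul (hb i) ih (abs_nonneg _) (he i)
    refine (add_le_add h2 h3).trans ?_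
    rw [pow_succ, ← hp]
    push_cast
    have h4 : 0 ≤ η * (m + 1) * p * κ * (e i * E) := by
      have := he i; positivity
    nlinarith

variable {𝒳 : Type*} [Fintype 𝒳]

/-- The multinomial weight of the vector of counts `N`, up to a factor that depends only on the
number of observations; it vanishes unless all counts are positive. -/
def countWeight (P : 𝒳 → ℝ) (n : ℕ) (N : 𝒳 → ℤ) : ℝ :=
  open Classical in if ∀ x, 0 < N x then ∏ x, poissonTerm (n * P x) (N x).toNat else 0

/-- The deviation of the counts `N` from their means, in units of the standard deviations of the
corresponding Poisson variables. -/
def scaledDeviation (P : 𝒳 → ℝ) (n : ℕ) (N : 𝒳 → ℤ) : EuclideanSpace ℝ 𝒳 :=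
  WithLp.toLp 2 fun x => (N x - n * P x) / √(n * P x)

theorem norm_sq_scaledDeviation (P : 𝒳 → ℝ) (n : ℕ) (N : 𝒳 → ℤ) :
    ‖scaledDeviation P n N‖ ^ 2 = ∑ x, ((N x - n * P x) / √(n * P x)) ^ 2 := by
  rw [EuclideanSpace.norm_sq_eq]
  simp only [scaledDeviation, Real.norm_eq_abs, sq_abs]

theorem countWeight_nonneg {P : 𝒳 → ℝ} (hP : ∀ x, 0 < P x) {n : ℕ} (hn : n ≠ 0) (N : 𝒳 → ℤ) :
    0 ≤ countWeight P n N := by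
  unfold countWeight
  split_ifs
  · exact Finset.prod_nonneg fun x _ => (poissonTerm_pos (by have := hP x; positivity) _).le
  · exact le_rfl

/-- Handles coset points outside the positive orthant, where the count weight is zero: there one
coordinate alone gives `‖scaledDeviation‖² ≥ n p`, so the Gaussian is itself within the permitted
error. -/
theorem exp_neg_scaledDeviation_le {P : 𝒳 → ℝ} {p : ℝ} (hp : 0 < p) (hP : ∀ x, p ≤ P x) {n : ℕ}
    (hn : n ≠ 0) {N : 𝒳 → ℤ} {x : 𝒳} (hx : N x ≤ 0) :
    Real.exp (-(‖scaledDeviation P n N‖ ^ 2 / 2)) ≤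
      4 / p / √n * Real.exp (-(1 / 4 * ‖scaledDeviation P n N‖ ^ 2)) := by
  have hn1 : (1 : ℝ) ≤ n := by exact_mod_cast Nat.one_le_iff_ne_zero.2 hn
  have hPx := hP x
  have hPx' := hp.trans_le hPx
  have hl : 0 < n * P x := by positivity
  have h1 : n * p ≤ ‖scaledDeviation P n N‖ ^ 2 := by
    rw [norm_sq_scaledDeviation]
    refine le_trans ?_ (Finset.single_le_sum (f := fun x => ((N x - n * P x) / √(n * P x)) ^ 2)
      (fun _ _ => sq_nonneg _) (Finset.mem_univ x))
    rw [div_pow, Real.sq_sqrt hl.le, le_div_iff₀ hl]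
    have hx' : (N x : ℝ) ≤ 0 := by exact_mod_cast hx
    have h2 : n * p ≤ n * P x := by gcongr
    have h3 : n * P x ≤ n * P x - N x := by linarith
    calc n * p * (n * P x) ≤ (n * P x - N x) * (n * P x - N x) := by gcongr <;> linarith
      _ = _ := by ring
  set t := ‖scaledDeviation P n N‖ ^ 2
  have h2 : Real.exp (-(t / 2)) = Real.exp (-(1 / 4 * t)) * Real.exp (-(1 / 4 * t)) := by
    rw [← Real.exp_add]; ring_nf
  rw [h2]
  gcongr
  have h3 := mul_exp_neg_le (t := t) (by norm_num : (0 : ℝ) < 1 / 4)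
  have h4 : √(n : ℝ) ≤ n := by
    rw [Real.sqrt_le_left (by linarith)]; nlinarith
  rw [div_div, le_div_iff₀ (by positivity)]
  calc Real.exp (-(1 / 4 * t)) * (p * √n) ≤ Real.exp (-(1 / 4 * t)) * (p * n) := by gcongr
    _ ≤ Real.exp (-(1 / 4 * t)) * t := by gcongr; linarith
    _ ≤ 4 := by linarith

set_option maxHeartbeats 400000 in
theorem countWeight_sub_gaussian_le {P : 𝒳 → ℝ} (hP : ∀ x, 0 < P x) (hP1 : ∑ x, P x = 1) :
    ∃ C : ℝ, 0 ≤ C ∧ ∃ c : ℝ, 0 < c ∧ c ≤ 1 / 2 ∧ ∀ (n : ℕ) (N : 𝒳 → ℤ), n ≠ 0 → ∑ x, N x = n →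
      |countWeight P n N - Real.exp (-(‖scaledDeviation P n N‖ ^ 2 / 2))| ≤
        C / √n * Real.exp (-(c * ‖scaledDeviation P n N‖ ^ 2)) := by
  have hne : Nonempty 𝒳 := by
    by_contra h
    rw [not_nonempty_iff] at h
    simp at hP1
  have hPle : ∀ x, P x ≤ 1 := fun x =>
    hP1 ▸ Finset.single_le_sum (fun y _ => (hP y).le) (Finset.mem_univ x)
  choose C hC c hc hc2 H using fun x => poissonTerm_sub_gaussian_le (M := 1 / P x) (l₀ := P x)
    ((one_le_div (hP x)).2 (hPle x)) (hP x)
  obtain ⟨x₁, hx₁⟩ := Finite.exists_min c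
  obtain ⟨x₂, hx₂⟩ := Finite.exists_min P
  set c₀ := c x₁
  set p := P x₂
  -- The error in coordinate `x` is `C x / √(n P x)`, so `κ / √n` dominates all of them.
  set κ := ∑ x, C x / √(P x) with hκ
  have hκ0 : 0 ≤ κ := Finset.sum_nonneg fun x _ => div_nonneg (hC x) (Real.sqrt_nonneg _)
  set C₁ := κ * ((Finset.univ : Finset 𝒳).card * (1 + κ) ^ (Finset.univ : Finset 𝒳).card) with hC₁
  have hC₁0 : 0 ≤ C₁ := by positivity
  have hp : 0 < p := hP x₂
  have hc₀ : 0 < c₀ := hc x₁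
  have hc₀2 : c₀ ≤ 1 / 2 := hc2 x₁
  refine ⟨max C₁ (4 / p), le_max_of_le_left hC₁0, c₀ / 2, by linarith, by linarith, ?_⟩
  intro n N hn hN
  have hn1 : (1 : ℝ) ≤ n := by exact_mod_cast Nat.one_le_iff_ne_zero.2 hn
  have hsn : 1 ≤ √(n : ℝ) := Real.one_le_sqrt.2 hn1
  by_cases hpos : ∀ x, 0 < N x
  · have hNn : ∀ x, N x ≤ n := fun x =>
      hN ▸ Finset.single_le_sum (fun y _ => (hpos y).le) (Finset.mem_univ x)
    have hcast : ∀ x, (((N x).toNat : ℕ) : ℝ) = N x := fun x => by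
      have := Int.toNat_of_nonneg (hpos x).le
      exact_mod_cast this
    have key := abs_prod_sub_prod_le Finset.univ (η := κ / √n) (κ := κ)
      (a := fun x => poissonTerm (n * P x) (N x).toNat)
      (b := fun x => Real.exp (-(((N x - n * P x) / √(n * P x)) ^ 2 / 2)))
      (e := fun x => Real.exp (-(c₀ * ((N x - n * P x) / √(n * P x)) ^ 2)))
      (by positivity) (div_le_self hκ0 hsn) (fun x => (Real.exp_pos _).le) (fun x => by
        rw [abs_of_pos (Real.exp_pos _)]
        apply Real.exp_le_exp.2
        nlinarith [sq_nonneg ((N x - n * P x) / √(n * P x))]) (fun x => by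
        have hPx := hP x
        have h1 := H x (n * P x) (N x).toNat (by nlinarith) (by have := hpos x; omega) (by
          rw [hcast]; field_simp; exact_mod_cast hNn x)
        rw [hcast] at h1
        refine h1.trans ?_
        have h2 : C x / √(P x) ≤ κ := Finset.single_le_sum
          (f := fun x => C x / √(P x)) (fun y _ => div_nonneg (hC y) (Real.sqrt_nonneg _))
          (Finset.mem_univ x)
        have h3 : C x / √(n * P x) = C x / √(P x) / √n := by
          rw [Real.sqrt_mul (by positivity), div_div, mul_comm]
        rw [h3]
        have h4 := hx₁ x
        gcongr)
    simp only [countWeight, if_pos hpos, norm_sq_scaledDeviation]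
    rw [← Real.exp_sum, ← Real.exp_sum] at key
    simp only [Finset.sum_neg_distrib, ← Finset.sum_div, ← Finset.mul_sum] at key
    refine key.trans ?_
    have h5 : 0 ≤ ∑ x, ((N x - n * P x) / √(n * P x)) ^ 2 := Finset.sum_nonneg fun _ _ => sq_nonneg _
    calc _ = C₁ / √n * Real.exp (-(c₀ * ∑ x, ((N x - n * P x) / √(n * P x)) ^ 2)) := by
          rw [hC₁]; ring
      _ ≤ _ := by
        gcongr
        · exact le_max_left _ _
        · linarith
  · rw [countWeight, if_neg hpos]
    push Not at hpos
    obtain ⟨x, hx⟩ := hpos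
    rw [zero_sub, abs_neg, abs_of_pos (Real.exp_pos _)]
    refine (exp_neg_scaledDeviation_le hp hx₂ hn hx).trans ?_
    refine mul_le_mul ?_ (Real.exp_le_exp.2 ?_) (Real.exp_pos _).le (by positivity)
    · gcongr
      exact le_max_right _ _
    · nlinarith [sq_nonneg ‖scaledDeviation P n N‖]

end

section

open Module
open scoped Pointwise

/-! ### Gaussian sums over lattices -/

section Lattice

variable {E : Type*} [NormedAddCommGroup E] [NormedSpace ℝ E] [FiniteDimensional ℝ E]

theorem exists_mem_lattice_norm_add_le (L : Submodule ℤ E) [DiscreteTopology L] [IsZLattice ℝ L] :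
    ∃ D : ℝ, 0 ≤ D ∧ ∀ x : E, ∃ l ∈ L, ‖x + l‖ ≤ D := by
  set b := (Free.chooseBasis ℤ L).ofZLatticeBasis ℝ
  obtain ⟨D, hD⟩ := (ZSpan.fundamentalDomain_isBounded b).exists_norm_le
  refine ⟨|D|, abs_nonneg _, fun x => ⟨-(ZSpan.floor b x : E), ?_, ?_⟩⟩
  · refine L.neg_mem ?_
    have := (ZSpan.floor b x).2
    exact (Basis.ofZLatticeBasis_span ℝ L (Free.chooseBasis ℤ L)).le this
  · rw [← sub_eq_add_neg]
    exact (hD _ (ZSpan.fract_mem_fundamentalDomain b x)).trans (le_abs_self _)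

/-- Sums over a translated and rescaled lattice are close to integrals. -/
theorem lattice_sum_sub_integral_le [MeasurableSpace E] [BorelSpace E] (μ : Measure E)
    [μ.IsAddHaarMeasure] (L : Submodule ℤ E) [DiscreteTopology L] [IsZLattice ℝ L] :
    ∃ κ : ℝ, 0 < κ ∧ ∃ D : ℝ, 0 ≤ D ∧ ∀ f g : E → ℝ, Integrable f μ → Integrable g μ →
      (∀ x, 0 ≤ g x) → (∀ x y, ‖x - y‖ ≤ D → |f x - f y| ≤ ‖x - y‖ * g y) → ∀ (t : ℝ), 1 ≤ t → ∀ a : E,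
      Summable (fun l : L => f (t⁻¹ • ((l : E) + a))) ∧
      |κ * ∑' l : L, f (t⁻¹ • ((l : E) + a)) - t ^ finrank ℝ E * ∫ x, f x ∂μ| ≤
        D / t * (t ^ finrank ℝ E * ∫ x, g x ∂μ) := by
  set β := Free.chooseBasis ℤ L
  set b := β.ofZLatticeBasis ℝ with hb
  set F := ZSpan.fundamentalDomain b with hFdef
  have hF : IsAddFundamentalDomain L F μ := ZLattice.isAddFundamentalDomain β μ
  -- The constant `κ` will be the volume of the fundamental domain, and `D` a bound for its points.
  have : VAddInvariantMeasure L E μ := ⟨fun c s _ => measure_preimage_add μ (c : E) s⟩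
  obtain ⟨D₀, hD₀⟩ := (ZSpan.fundamentalDomain_isBounded b).exists_norm_le
  have hfin : μ F < ⊤ := (ZSpan.fundamentalDomain_isBounded b).measure_lt_top
  refine ⟨μ.real F, ENNReal.toReal_pos (ZSpan.measure_fundamentalDomain_ne_zero b) hfin.ne,
    |D₀|, abs_nonneg _, ?_⟩
  set D := |D₀|
  intro f g hf hg hg0 hfg t ht a
  have ht0 : 0 < t := one_pos.trans_le ht
  have hscale : ∀ {h : E → ℝ}, Integrable h μ → HasSum (fun l : L =>
      ∫ x in l +ᵥ F, h (t⁻¹ • (x + a)) ∂μ) (t ^ finrank ℝ E * ∫ x, h x ∂μ) ∧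
      Integrable (fun x => h (t⁻¹ • (x + a))) μ := by
    intro h hh
    have h1 : Integrable (fun x => h (t⁻¹ • (x + a))) μ :=
      (hh.comp_smul (R := t⁻¹) (inv_ne_zero ht0.ne')).comp_add_right a
    refine ⟨?_, h1⟩
    have h2 := hasSum_integral_measure (μ := fun l : L => μ.restrict (l +ᵥ F))
      (f := fun x => h (t⁻¹ • (x + a))) (by rw [hF.sum_restrict]; exact h1)
    rw [hF.sum_restrict] at h2
    have h3 : ∫ x, h (t⁻¹ • (x + a)) ∂μ = t ^ finrank ℝ E * ∫ x, h x ∂μ := by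
      rw [integral_add_right_eq_self (fun x => h (t⁻¹ • x)) a,
        Measure.integral_comp_inv_smul_of_nonneg μ h ht0.le, smul_eq_mul]
    rwa [h3] at h2
  obtain ⟨hfs, hfi⟩ := hscale hf
  obtain ⟨hgs, hgi⟩ := hscale hg
  have hmeas : ∀ l : L, MeasurableSet (l +ᵥ F) := fun l =>
    (ZSpan.fundamentalDomain_measurableSet b).const_vadd l
  have hvol : ∀ l : L, μ (l +ᵥ F) = μ F := fun l => by
    have : (l +ᵥ F : Set E) = (l : E) +ᵥ F := rfl
    rw [this, measure_vadd]
  -- Comparison of one cell with the sample at its lattice point. The modulus `g` is taken at the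
  -- moving point of the cell, so the errors add up to the integral of `g`.
  have hcell : ∀ l : L, |∫ x in l +ᵥ F, f (t⁻¹ • (x + a)) ∂μ -
      μ.real F * f (t⁻¹ • ((l : E) + a))| ≤ D / t * ∫ x in l +ᵥ F, g (t⁻¹ • (x + a)) ∂μ := by
    intro l
    have h1 : μ.real F * f (t⁻¹ • ((l : E) + a)) =
        ∫ x in l +ᵥ F, f (t⁻¹ • ((l : E) + a)) ∂μ := by
      rw [setIntegral_const, measureReal_def, measureReal_def, hvol, smul_eq_mul]
    have hconst : IntegrableOn (fun _ : E => f (t⁻¹ • ((l : E) + a))) (l +ᵥ F) μ :=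
      integrableOn_const (by rw [hvol]; exact hfin.ne)
    rw [h1, ← integral_sub hfi.integrableOn hconst, ← integral_const_mul, ← Real.norm_eq_abs]
    refine norm_integral_le_of_norm_le (hgi.integrableOn.const_mul _) ?_
    refine (ae_restrict_iff' (hmeas l)).2 (Filter.Eventually.of_forall fun x hx => ?_)
    obtain ⟨y, hy, rfl⟩ := hx
    have hdiff : t⁻¹ • (((l : E) + a)) - t⁻¹ • (((l +ᵥ y : E)) + a) = -(t⁻¹ • y) := by
      have : (l +ᵥ y : E) = (l : E) + y := rfl
      rw [this, ← smul_sub, ← smul_neg]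
      congr 1
      abel
    have hnorm : ‖t⁻¹ • (((l : E) + a)) - t⁻¹ • (((l +ᵥ y : E)) + a)‖ ≤ D / t := by
      rw [hdiff, norm_neg, norm_smul, norm_inv, Real.norm_of_nonneg ht0.le, ← div_eq_inv_mul]
      gcongr
      exact (hD₀ y hy).trans (le_abs_self _)
    have h4 := hfg _ _ (hnorm.trans (div_le_self (abs_nonneg _) ht))
    rw [Real.norm_eq_abs, abs_sub_comm]
    exact h4.trans (mul_le_mul_of_nonneg_right hnorm (hg0 _))
  have hsum : Summable fun l : L => ∫ x in l +ᵥ F, f (t⁻¹ • (x + a)) ∂μ -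
      μ.real F * f (t⁻¹ • ((l : E) + a)) :=
    Summable.of_norm_bounded (hgs.summable.mul_left (D / t)) hcell
  have hFpos : μ.real F ≠ 0 :=
    (ENNReal.toReal_pos (ZSpan.measure_fundamentalDomain_ne_zero b) hfin.ne).ne'
  have hsum' : Summable fun l : L => f (t⁻¹ • ((l : E) + a)) := by
    have := hfs.summable.sub hsum
    simp only [sub_sub_cancel] at this
    exact (summable_mul_left_iff hFpos).1 this
  refine ⟨hsum', ?_⟩
  rw [← hfs.tsum_eq, ← hgs.tsum_eq, ← tsum_mul_left, ← tsum_mul_left, abs_sub_comm,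
    ← hfs.summable.tsum_sub (hsum'.mul_left _), ← Real.norm_eq_abs]
  exact tsum_of_norm_bounded (hgs.summable.mul_left (D / t)).hasSum hcell

end Lattice

/-- Provides the modulus `g` for `lattice_sum_sub_integral_le`. The rate falls to `b/2` when `‖x‖`
is replaced by `‖y‖`, through `‖y‖² ≤ 2‖x‖² + 2D²`, and to `b/4` when the polynomial factor is
absorbed. -/
theorem abs_gaussian_sub_le {E : Type*} [NormedAddCommGroup E] {b D : ℝ} (hb : 0 < b) (hD : 0 ≤ D) :
    ∃ K : ℝ, 0 ≤ K ∧ ∀ x y : E, ‖x - y‖ ≤ D →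
      |Real.exp (-(b * ‖x‖ ^ 2)) - Real.exp (-(b * ‖y‖ ^ 2))| ≤
        ‖x - y‖ * (K * Real.exp (-(b / 4 * ‖y‖ ^ 2))) := by
  refine ⟨b * (Real.exp (b * D ^ 2) + 1) * ((5 + (2 + D)) * (1 + 2 / (b / 4) ^ 2)), by positivity,
    fun x y hxy => ?_⟩
  have h1 : |‖x‖ - ‖y‖| ≤ ‖x - y‖ := abs_norm_sub_norm_le x y
  have h2 := abs_le.1 h1
  have hx := norm_nonneg x
  have hy := norm_nonneg y
  have hfx : Real.exp (-(b * ‖x‖ ^ 2)) ≤ Real.exp (b * D ^ 2) * Real.exp (-(b / 2 * ‖y‖ ^ 2)) := by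
    rw [← Real.exp_add]
    apply Real.exp_le_exp.2
    have : ‖y‖ ^ 2 ≤ 2 * ‖x‖ ^ 2 + 2 * D ^ 2 := by
      nlinarith [sq_nonneg (‖x‖ - D), h2.1]
    nlinarith
  have hfy : Real.exp (-(b * ‖y‖ ^ 2)) ≤ Real.exp (-(b / 2 * ‖y‖ ^ 2)) := by
    apply Real.exp_le_exp.2; nlinarith [sq_nonneg ‖y‖]
  have hsplit : Real.exp (-(b / 2 * ‖y‖ ^ 2)) =
      Real.exp (-(b / 4 * ‖y‖ ^ 2)) * Real.exp (-(b / 4 * ‖y‖ ^ 2)) := by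
    rw [← Real.exp_add]; ring_nf
  have hdiff : |-(b * ‖x‖ ^ 2) - -(b * ‖y‖ ^ 2)| ≤
      b * ‖x - y‖ * (|‖y‖| + 4 * |‖y‖| ^ 3 + (2 + D)) := by
    have : -(b * ‖x‖ ^ 2) - -(b * ‖y‖ ^ 2) = -(b * ((‖x‖ - ‖y‖) * (‖x‖ + ‖y‖))) := by ring
    rw [this, abs_neg, abs_mul, abs_mul, abs_of_pos hb, abs_of_nonneg (by positivity : 0 ≤ ‖x‖ + ‖y‖),
      abs_of_nonneg hy, mul_assoc]
    have h5 : ‖x‖ + ‖y‖ ≤ ‖y‖ + 4 * ‖y‖ ^ 3 + (2 + D) := by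
      have : ‖y‖ ≤ 4 * ‖y‖ ^ 3 + 2 := by nlinarith [mul_nonneg hy (sq_nonneg (‖y‖ - 1 / 2))]
      linarith [h2.2]
    gcongr
  have hpoly := poly_mul_exp_neg_le (c := b / 4) (K := 2 + D) (z := ‖y‖) (by positivity)
    (by positivity)
  set P := |‖y‖| + 4 * |‖y‖| ^ 3 + (2 + D)
  set e := Real.exp (-(b / 4 * ‖y‖ ^ 2))
  have he : 0 < e := Real.exp_pos _
  refine (abs_exp_sub_exp_le _ _).trans ?_
  have hP : 0 ≤ P := by positivity
  calc _ ≤ (b * ‖x - y‖ * P) * (Real.exp (b * D ^ 2) * (e * e) + e * e) := by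
        rw [← hsplit]
        exact mul_le_mul hdiff (add_le_add hfx hfy) (by positivity) (by positivity)
    _ = ‖x - y‖ * (b * (Real.exp (b * D ^ 2) + 1) * (P * e) * e) := by ring
    _ ≤ _ := by gcongr

/-- The integral does not see the shift `a`, so neither `I` nor `C` depends on it; this uniformity
is what lets all cosets share one constant. -/
theorem gaussian_lattice_sum {E : Type*} [NormedAddCommGroup E] [InnerProductSpace ℝ E]
    [FiniteDimensional ℝ E] (L : Submodule ℤ E) [DiscreteTopology L]
    [IsZLattice ℝ L] {b : ℝ} (hb : 0 < b) :
    ∃ I : ℝ, 0 < I ∧ ∃ C : ℝ, 0 ≤ C ∧ ∀ t : ℝ, 1 ≤ t → ∀ a : E,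
      Summable (fun l : L => Real.exp (-(b * ‖t⁻¹ • ((l : E) + a)‖ ^ 2))) ∧
      |∑' l : L, Real.exp (-(b * ‖t⁻¹ • ((l : E) + a)‖ ^ 2)) - t ^ finrank ℝ E * I| ≤
        C / t * t ^ finrank ℝ E := by
  let _ : MeasurableSpace E := borel E
  have : BorelSpace E := ⟨rfl⟩
  obtain ⟨κ, hκ, D, hD, H⟩ := lattice_sum_sub_integral_le (volume : Measure E) L
  obtain ⟨K, hK, hKf⟩ := abs_gaussian_sub_le (E := E) hb hD
  have hint : ∀ {b : ℝ}, 0 < b → 0 < ∫ x : E, Real.exp (-(b * ‖x‖ ^ 2)) := fun {b} hb => by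
    have := GaussianFourier.integral_rexp_neg_mul_sq_norm (V := E) hb
    simp only [neg_mul] at this
    rw [this]
    have := Real.pi_pos
    positivity
  -- The integral of a non-integrable function is zero by convention, so a positive value forces
  -- integrability.
  have hintegrable : ∀ {b : ℝ}, 0 < b → Integrable (fun x : E => Real.exp (-(b * ‖x‖ ^ 2))) :=
    fun hb => by
      by_contra h
      have := hint hb
      rw [integral_undef h] at this
      exact this.false
  set I := ∫ x : E, Real.exp (-(b * ‖x‖ ^ 2))
  set J := ∫ x : E, K * Real.exp (-(b / 4 * ‖x‖ ^ 2)) with hJ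
  have hb4 : 0 < b / 4 := by positivity
  have hJ0 : 0 ≤ J := integral_nonneg fun x => by positivity
  refine ⟨I / κ, div_pos (hint hb) hκ, D * J / κ, by positivity, fun t ht a => ?_⟩
  obtain ⟨h1, h2⟩ := H (fun x => Real.exp (-(b * ‖x‖ ^ 2))) _ (hintegrable hb)
    ((hintegrable hb4).const_mul K) (fun x => by positivity) hKf t ht a
  refine ⟨h1, ?_⟩
  have ht0 : 0 < t := one_pos.trans_le ht
  rw [← mul_le_mul_iff_of_pos_left hκ]
  calc _ = |κ * ∑' l : L, Real.exp (-(b * ‖t⁻¹ • ((l : E) + a)‖ ^ 2)) - t ^ finrank ℝ E * I| := by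
        rw [← abs_of_pos hκ, ← abs_mul, abs_of_pos hκ]
        congr 1
        field_simp
    _ ≤ D / t * (t ^ finrank ℝ E * J) := h2
    _ = _ := by field_simp

end

section

open Module

/-! ### Sums of count weights over cosets of lattices of integer vectors -/

set_option linter.unusedSectionVars false

variable {𝒳 : Type*} [Fintype 𝒳]

/-- Division of the coordinates by the standard deviations `√(P x)`. -/
def whiten (P : 𝒳 → ℝ) : (𝒳 → ℝ) →ₗ[ℝ] EuclideanSpace ℝ 𝒳 where
  toFun v := WithLp.toLp 2 fun x => v x / √(P x)
  map_add' v w := by ext x; simp [add_div]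
  map_smul' c v := by ext x; simp [mul_div_assoc]

@[simp]
theorem whiten_apply (P v : 𝒳 → ℝ) (x : 𝒳) : whiten P v x = v x / √(P x) := rfl

theorem whiten_injective {P : 𝒳 → ℝ} (hP : ∀ x, 0 < P x) : Function.Injective (whiten P) := by
  intro v w h
  ext x
  have h1 := congrArg (fun u : EuclideanSpace ℝ 𝒳 => u x) h
  have := Real.sqrt_pos.2 (hP x)
  simpa [this.ne'] using h1

theorem norm_sq_whiten {P : 𝒳 → ℝ} (hP : ∀ x, 0 < P x) (v : 𝒳 → ℝ) :
    ‖whiten P v‖ ^ 2 = ∑ x, v x ^ 2 / P x := by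
  rw [EuclideanSpace.norm_sq_eq]
  refine Finset.sum_congr rfl fun x _ => ?_
  rw [Real.norm_eq_abs, sq_abs, whiten_apply, div_pow, Real.sq_sqrt (hP x).le]

theorem scaledDeviation_eq (P : 𝒳 → ℝ) (n : ℕ) (N : 𝒳 → ℤ) :
    scaledDeviation P n N = (√n)⁻¹ • whiten P (fun x => N x - n * P x) := by
  ext x
  simp only [scaledDeviation, PiLp.smul_apply, whiten_apply, smul_eq_mul]
  rw [Real.sqrt_mul (Nat.cast_nonneg n)]
  field_simp

theorem scaledDeviation_add (P : 𝒳 → ℝ) (n : ℕ) (N z : 𝒳 → ℤ) :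
    scaledDeviation P n (N + z) =
      scaledDeviation P n N + (√n)⁻¹ • whiten P (fun x => (z x : ℝ)) := by
  rw [scaledDeviation_eq, scaledDeviation_eq, ← smul_add, ← map_add]
  congr 2
  ext x
  simp only [Pi.add_apply, Int.cast_add]
  ring

/-- The integer vectors in a subspace. -/
def integerVectors (S : Submodule ℝ (𝒳 → ℝ)) : AddSubgroup (𝒳 → ℤ) where
  carrier := {z | (fun x => (z x : ℝ)) ∈ S}
  zero_mem' := by
    have h : (fun x => (((0 : 𝒳 → ℤ) x : ℤ) : ℝ)) = 0 := by ext x; simp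
    exact Set.mem_ofPred.2 (h.symm ▸ S.zero_mem)
  add_mem' {z w} hz hw := by
    have h : (fun x => (((z + w) x : ℤ) : ℝ)) = (fun x => (z x : ℝ)) + fun x => (w x : ℝ) := by
      ext x; simp
    exact Set.mem_ofPred.2 (h.symm ▸ S.add_mem hz hw)
  neg_mem' {z} hz := by
    have h : (fun x => (((-z) x : ℤ) : ℝ)) = -fun x => (z x : ℝ) := by ext x; simp
    exact Set.mem_ofPred.2 (h.symm ▸ S.neg_mem hz)

theorem mem_integerVectors {S : Submodule ℝ (𝒳 → ℝ)} {z : 𝒳 → ℤ} :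
    z ∈ integerVectors S ↔ (fun x => (z x : ℝ)) ∈ S := Iff.rfl

/-- The whitened integer vectors in a subspace, as a lattice in the whitened subspace. -/
def whitenedLattice (P : 𝒳 → ℝ) (S : Submodule ℝ (𝒳 → ℝ)) : Submodule ℤ (S.map (whiten P)) where
  carrier := {w | ∃ z ∈ integerVectors S, whiten P (fun x => (z x : ℝ)) = w}
  zero_mem' := ⟨0, zero_mem _, by
    simp only [Pi.zero_apply, Int.cast_zero, ZeroMemClass.coe_zero]
    exact map_zero (whiten P)⟩
  add_mem' := by
    rintro v w ⟨z, hz, hv⟩ ⟨y, hy, hw⟩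
    refine ⟨z + y, add_mem hz hy, ?_⟩
    rw [Submodule.coe_add, ← hv, ← hw, ← map_add]
    congr 1
    ext x
    simp
  smul_mem' := by
    rintro k v ⟨z, hz, hv⟩
    refine ⟨k • z, zsmul_mem hz k, ?_⟩
    rw [Submodule.coe_smul_of_tower, ← hv, ← map_zsmul]
    congr 1
    ext x
    simp

/-- Dividing by `√(P x) ≤ 1` shrinks no coordinate, so whitened integer vectors stay at distance at
least one from each other. -/
theorem one_le_norm_whiten {P : 𝒳 → ℝ} (hP : ∀ x, 0 < P x) (hP1 : ∀ x, P x ≤ 1) {z : 𝒳 → ℤ}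
    (hz : z ≠ 0) : 1 ≤ ‖whiten P (fun x => (z x : ℝ))‖ := by
  obtain ⟨x, hx⟩ := Function.ne_iff.1 hz
  refine le_trans ?_ (PiLp.norm_apply_le _ x)
  rw [whiten_apply, Real.norm_eq_abs, abs_div, abs_of_nonneg (Real.sqrt_nonneg _),
    one_le_div (Real.sqrt_pos.2 (hP x))]
  have h1 : √(P x) ≤ 1 := Real.sqrt_le_one.2 (hP1 x)
  have h2 : (1 : ℝ) ≤ |(z x : ℝ)| := by exact_mod_cast Int.one_le_abs hx
  linarith

theorem discreteTopology_whitenedLattice {P : 𝒳 → ℝ} (hP : ∀ x, 0 < P x) (hP1 : ∀ x, P x ≤ 1)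
    (S : Submodule ℝ (𝒳 → ℝ)) : DiscreteTopology (whitenedLattice P S) := by
  refine DiscreteTopology.of_forall_le_dist one_pos ?_
  rintro ⟨⟨v, hvS⟩, z, hz, hv⟩ ⟨⟨w, hwS⟩, y, hy, hw⟩ hne
  simp only at hv hw
  rw [Subtype.dist_eq, Subtype.dist_eq, dist_eq_norm]
  simp only
  rw [← hv, ← hw, ← map_sub]
  have hzy : z - y ≠ 0 := by
    rintro h
    apply hne
    rw [sub_eq_zero] at h
    subst h
    simp [← hv, ← hw]
  convert! one_le_norm_whiten hP hP1 hzy using 3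
  ext x
  simp

theorem span_whitenedLattice (P : 𝒳 → ℝ) {S : Submodule ℝ (𝒳 → ℝ)}
    (hS : SpannedByIntegerVectors S) :
    Submodule.span ℝ (whitenedLattice P S : Set (S.map (whiten P))) = ⊤ := by
  rw [eq_top_iff]
  rintro ⟨w, v, hv, rfl⟩ -
  have key : ∀ v ∈ Submodule.span ℝ {v : 𝒳 → ℝ | v ∈ S ∧ ∀ x, ∃ z : ℤ, v x = z},
      ∀ h : whiten P v ∈ S.map (whiten P), (⟨whiten P v, h⟩ : S.map (whiten P)) ∈
        Submodule.span ℝ (whitenedLattice P S : Set (S.map (whiten P))) := by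
    intro v hv
    induction hv using Submodule.span_induction with
    | mem v hv =>
      intro h
      obtain ⟨hvS, hz⟩ := hv
      choose z hz using hz
      have hvz : v = fun x => (z x : ℝ) := funext hz
      refine Submodule.subset_span ⟨z, ?_, ?_⟩
      · rw [mem_integerVectors, ← hvz]; exact hvS
      · rw [← hvz]
    | zero =>
      intro h
      convert! Submodule.zero_mem _
      exact map_zero (whiten P)
    | add v w hv hw ihv ihw =>
      intro h
      rw [hS] at hv hw
      convert! Submodule.add_mem _ (ihv ⟨v, hv, rfl⟩) (ihw ⟨w, hw, rfl⟩)
      exact map_add (whiten P) v w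
    | smul c v hv ih =>
      intro h
      rw [hS] at hv
      convert! Submodule.smul_mem _ c (ih ⟨v, hv, rfl⟩)
      exact map_smul (whiten P) c v
  exact key v (by rw [hS]; exact hv) _

/-- Whitening as a bijection from the integer vectors in a subspace to the whitened lattice. -/
def integerVectorsEquiv {P : 𝒳 → ℝ} (hP : ∀ x, 0 < P x) (S : Submodule ℝ (𝒳 → ℝ)) :
    integerVectors S ≃ whitenedLattice P S :=
  Equiv.ofBijective (fun z => ⟨⟨whiten P fun x => (z.1 x : ℝ), _, z.2, rfl⟩, z.1, z.2, rfl⟩) <| by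
    constructor
    · rintro ⟨z, hz⟩ ⟨y, hy⟩ h
      have := whiten_injective hP (congrArg Subtype.val (congrArg Subtype.val h))
      ext x
      exact_mod_cast congrFun this x
    · rintro ⟨⟨w, hw⟩, z, hz, hzw⟩
      exact ⟨⟨z, hz⟩, Subtype.ext (Subtype.ext hzw)⟩

theorem coe_integerVectorsEquiv {P : 𝒳 → ℝ} (hP : ∀ x, 0 < P x) (S : Submodule ℝ (𝒳 → ℝ))
    (z : integerVectors S) :
    ((integerVectorsEquiv hP S z : S.map (whiten P)) : EuclideanSpace ℝ 𝒳) =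
      whiten P fun x => (z.1 x : ℝ) := rfl

theorem exists_integerVector_norm_le {P : 𝒳 → ℝ} (hP : ∀ x, 0 < P x) (hP1 : ∀ x, P x ≤ 1)
    {S : Submodule ℝ (𝒳 → ℝ)} (hS : SpannedByIntegerVectors S) :
    ∃ D : ℝ, 0 ≤ D ∧ ∀ v ∈ S, ∃ z ∈ integerVectors S,
      ‖whiten P v + whiten P (fun x => (z x : ℝ))‖ ≤ D := by
  have := discreteTopology_whitenedLattice hP hP1 S
  have : IsZLattice ℝ (whitenedLattice P S) := ⟨span_whitenedLattice P hS⟩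
  obtain ⟨D, hD, H⟩ := exists_mem_lattice_norm_add_le (whitenedLattice P S)
  refine ⟨D, hD, fun v hv => ?_⟩
  obtain ⟨l, ⟨z, hz, hzl⟩, hl⟩ := H ⟨whiten P v, v, hv, rfl⟩
  refine ⟨z, hz, ?_⟩
  rwa [hzl]

/-- By Pythagoras the component `m`, shared by the whole coset, factors out of the sum. What is left
is a Gaussian sum over the whitened lattice at scale `√n`, with shift `√n • s`. -/
theorem gaussian_coset_sum {P : 𝒳 → ℝ} (hP : ∀ x, 0 < P x) (hP1 : ∀ x, P x ≤ 1)
    {S : Submodule ℝ (𝒳 → ℝ)} (hS : SpannedByIntegerVectors S) {b : ℝ} (hb : 0 < b) :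
    ∃ I : ℝ, 0 < I ∧ ∃ C : ℝ, 0 ≤ C ∧ ∀ (n : ℕ) (N : 𝒳 → ℤ) (m s : EuclideanSpace ℝ 𝒳), n ≠ 0 →
      scaledDeviation P n N = m + s → s ∈ S.map (whiten P) → m ∈ (S.map (whiten P))ᗮ →
      Summable (fun z : integerVectors S => Real.exp (-(b * ‖scaledDeviation P n (N + z)‖ ^ 2))) ∧
      |∑' z : integerVectors S, Real.exp (-(b * ‖scaledDeviation P n (N + z)‖ ^ 2)) -
        √n ^ finrank ℝ S * (I * Real.exp (-(b * ‖m‖ ^ 2)))| ≤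
          √n ^ finrank ℝ S * (C / √n * Real.exp (-(b * ‖m‖ ^ 2))) := by
  have := discreteTopology_whitenedLattice hP hP1 S
  have : IsZLattice ℝ (whitenedLattice P S) := ⟨span_whitenedLattice P hS⟩
  obtain ⟨I, hI, C, hC, H⟩ := gaussian_lattice_sum (whitenedLattice P S) hb
  refine ⟨I, hI, C, hC, fun n N m s hn hN hs hm => ?_⟩
  have hn1 : (1 : ℝ) ≤ n := by exact_mod_cast Nat.one_le_iff_ne_zero.2 hn
  have ht : 1 ≤ √(n : ℝ) := Real.one_le_sqrt.2 hn1
  have ht0 : 0 < √(n : ℝ) := one_pos.trans_le ht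
  obtain ⟨h1, h2⟩ := H (√n) ht (√n • (⟨s, hs⟩ : S.map (whiten P)))
  have hfin : finrank ℝ (S.map (whiten P)) = finrank ℝ S :=
    (Submodule.equivMapOfInjective _ (whiten_injective hP) S).finrank_eq.symm
  have hterm : ∀ z : integerVectors S, Real.exp (-(b * ‖scaledDeviation P n (N + z)‖ ^ 2)) =
      Real.exp (-(b * ‖m‖ ^ 2)) * Real.exp (-(b * ‖(√n)⁻¹ •
        (((integerVectorsEquiv hP S z : whitenedLattice P S) : S.map (whiten P)) +
          √n • (⟨s, hs⟩ : S.map (whiten P)))‖ ^ 2)) := by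
    intro z
    rw [← Real.exp_add, scaledDeviation_add, hN, smul_add, smul_smul, inv_mul_cancel₀ ht0.ne',
      one_smul]
    congr 1
    have h3 : m + s + (√n)⁻¹ • whiten P (fun x => (z.1 x : ℝ)) =
        m + (((√n)⁻¹ • ((integerVectorsEquiv hP S z : whitenedLattice P S) : S.map (whiten P)) +
          (⟨s, hs⟩ : S.map (whiten P)) : S.map (whiten P)) : EuclideanSpace ℝ 𝒳) := by
      rw [Submodule.coe_add, Submodule.coe_smul, coe_integerVectorsEquiv]
      abel
    rw [h3, sq, norm_add_sq_eq_norm_sq_add_norm_sq_real, Submodule.coe_norm]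
    · ring
    · exact Submodule.inner_left_of_mem_orthogonal (Subtype.mem _) hm
  simp only [hterm]
  refine ⟨(((integerVectorsEquiv hP S).summable_iff).2 h1).mul_left _, ?_⟩
  rw [tsum_mul_left, (integerVectorsEquiv hP S).tsum_eq (fun l : whitenedLattice P S =>
    Real.exp (-(b * ‖(√n)⁻¹ • ((l : S.map (whiten P)) +
      √n • (⟨s, hs⟩ : S.map (whiten P)))‖ ^ 2)))]
  rw [hfin] at h2
  have h4 := mul_le_mul_of_nonneg_left h2 (Real.exp_pos (-(b * ‖m‖ ^ 2))).le
  rw [← abs_of_pos (Real.exp_pos (-(b * ‖m‖ ^ 2))), ← abs_mul,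
    abs_of_pos (Real.exp_pos (-(b * ‖m‖ ^ 2))), mul_sub] at h4
  convert! h4 using 1
  · congr 2; ring
  · ring

end

/-! ### Total mass and tails of the count weights on a coset -/

section

open Module

variable {𝒳 : Type*} [Fintype 𝒳]

theorem sum_add_integerVectors {S : Submodule ℝ (𝒳 → ℝ)} (hS0 : ∀ v ∈ S, ∑ x, v x = 0) {n : ℕ}
    {N : 𝒳 → ℤ} (hN : ∑ x, N x = n) (z : integerVectors S) : ∑ x, (N + z.1) x = n := by
  have h1 : ∑ x, z.1 x = 0 := by exact_mod_cast hS0 _ (mem_integerVectors.1 z.2)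
  simp [Finset.sum_add_distrib, hN, h1]

/-- The count weights of the points of a coset of the lattice of integer vectors in `S` add up to
a Gaussian function of the distance of the coset from the mean. -/
theorem countWeight_coset_sum {P : 𝒳 → ℝ} (hP : ∀ x, 0 < P x) (hP1 : ∑ x, P x = 1)
    {S : Submodule ℝ (𝒳 → ℝ)} (hS : SpannedByIntegerVectors S) (hS0 : ∀ v ∈ S, ∑ x, v x = 0) :
    ∃ I : ℝ, 0 < I ∧ ∃ C : ℝ, 0 ≤ C ∧ ∀ (n : ℕ) (N : 𝒳 → ℤ) (m s : EuclideanSpace ℝ 𝒳), n ≠ 0 →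
      ∑ x, N x = n → scaledDeviation P n N = m + s → s ∈ S.map (whiten P) →
      m ∈ (S.map (whiten P))ᗮ →
      Summable (fun z : integerVectors S => countWeight P n (N + z)) ∧
      |∑' z : integerVectors S, countWeight P n (N + z) -
        √n ^ finrank ℝ S * (I * Real.exp (-(‖m‖ ^ 2 / 2)))| ≤ √n ^ finrank ℝ S * (C / √n) := by
  have hPle : ∀ x, P x ≤ 1 := fun x =>
    hP1 ▸ Finset.single_le_sum (fun y _ => (hP y).le) (Finset.mem_univ x)
  obtain ⟨C₀, hC₀, c, hc, -, H₀⟩ := countWeight_sub_gaussian_le hP hP1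
  -- Rate `1/2` gives the main term; rate `c` sums the pointwise error of the local limit theorem.
  obtain ⟨I, hI, C₁, hC₁, H₁⟩ := gaussian_coset_sum hP hPle hS (b := 1 / 2) (by norm_num)
  obtain ⟨J, hJ, C₂, hC₂, H₂⟩ := gaussian_coset_sum hP hPle hS hc
  refine ⟨I, hI, C₀ * (J + C₂) + C₁, by positivity, fun n N m s hn hNn hN hs hm => ?_⟩
  have hn1 : (1 : ℝ) ≤ n := by exact_mod_cast Nat.one_le_iff_ne_zero.2 hn
  have ht : 1 ≤ √(n : ℝ) := Real.one_le_sqrt.2 hn1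
  have ht0 : 0 < √(n : ℝ) := one_pos.trans_le ht
  obtain ⟨hs₁, h₁⟩ := H₁ n N m s hn hN hs hm
  obtain ⟨hs₂, h₂⟩ := H₂ n N m s hn hN hs hm
  have hhalf : ∀ u : ℝ, 1 / 2 * u = u / 2 := fun u => by ring
  simp only [hhalf] at hs₁ h₁
  have hterm : ∀ z : integerVectors S, |countWeight P n (N + z) -
      Real.exp (-(‖scaledDeviation P n (N + z)‖ ^ 2 / 2))| ≤
      C₀ / √n * Real.exp (-(c * ‖scaledDeviation P n (N + z)‖ ^ 2)) := fun z =>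
    H₀ n (N + z) hn (by exact_mod_cast sum_add_integerVectors hS0 hNn z)
  have hd : Summable fun z : integerVectors S => countWeight P n (N + z) -
      Real.exp (-(‖scaledDeviation P n (N + z)‖ ^ 2 / 2)) :=
    Summable.of_norm_bounded (hs₂.mul_left _) hterm
  have hsum : Summable fun z : integerVectors S => countWeight P n (N + z) := by
    simpa using hd.add hs₁
  refine ⟨hsum, ?_⟩
  have h3 : |∑' z : integerVectors S, countWeight P n (N + z) - ∑' z : integerVectors S,
      Real.exp (-(‖scaledDeviation P n (N + z)‖ ^ 2 / 2))| ≤ C₀ / √n *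
        ∑' z : integerVectors S, Real.exp (-(c * ‖scaledDeviation P n (N + z)‖ ^ 2)) := by
    rw [← hsum.tsum_sub hs₁, ← tsum_mul_left]
    rw [← Real.norm_eq_abs]
    exact tsum_of_norm_bounded (hs₂.mul_left (C₀ / √n)).hasSum hterm
  have hexp : ∀ {b : ℝ}, 0 < b → Real.exp (-(b * ‖m‖ ^ 2)) ≤ 1 := fun hb => by
    rw [Real.exp_le_one_iff]; have := mul_nonneg hb.le (sq_nonneg ‖m‖); linarith
  have h4 : ∑' z : integerVectors S, Real.exp (-(c * ‖scaledDeviation P n (N + z)‖ ^ 2)) ≤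
      √n ^ finrank ℝ S * (J + C₂) := by
    have h5 : √n ^ finrank ℝ S * (J * Real.exp (-(c * ‖m‖ ^ 2))) ≤ √n ^ finrank ℝ S * (J * 1) := by
      have := hexp hc
      gcongr
    have h6 : √n ^ finrank ℝ S * (C₂ / √n * Real.exp (-(c * ‖m‖ ^ 2))) ≤
        √n ^ finrank ℝ S * (C₂ * 1) := by
      have := hexp hc
      have := div_le_self hC₂ ht
      gcongr
    linarith [(abs_le.1 h₂).2]
  have h7 : √n ^ finrank ℝ S * (C₁ / √n * Real.exp (-(‖m‖ ^ 2 / 2))) ≤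
      √n ^ finrank ℝ S * (C₁ / √n * 1) := by
    have := hexp (b := 1 / 2) (by norm_num)
    rw [hhalf] at this
    gcongr
  calc _ ≤ |∑' z : integerVectors S, countWeight P n (N + z) - ∑' z : integerVectors S,
      Real.exp (-(‖scaledDeviation P n (N + z)‖ ^ 2 / 2))| +
      |∑' z : integerVectors S, Real.exp (-(‖scaledDeviation P n (N + z)‖ ^ 2 / 2)) -
        √n ^ finrank ℝ S * (I * Real.exp (-(‖m‖ ^ 2 / 2)))| := abs_sub_le _ _ _
    _ ≤ C₀ / √n * (√n ^ finrank ℝ S * (J + C₂)) + √n ^ finrank ℝ S * (C₁ / √n * 1) := by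
      gcongr
      · exact h3.trans (by gcongr)
      · exact h₁.trans h7
    _ = _ := by ring

/-- The points of a coset that are far from the mean have a small total count weight. -/
theorem countWeight_coset_tail_le {P : 𝒳 → ℝ} (hP : ∀ x, 0 < P x) (hP1 : ∑ x, P x = 1)
    {S : Submodule ℝ (𝒳 → ℝ)} (hS : SpannedByIntegerVectors S) (hS0 : ∀ v ∈ S, ∑ x, v x = 0) :
    ∃ C : ℝ, 0 ≤ C ∧ ∃ c : ℝ, 0 < c ∧ ∀ (n : ℕ) (N : 𝒳 → ℤ) (K : ℝ), n ≠ 0 →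
      ∑ x, N x = n → 0 ≤ K →
      ∑' z : integerVectors S, (if K < ‖scaledDeviation P n (N + z)‖ then
        countWeight P n (N + z) else 0) ≤ √n ^ finrank ℝ S * (C * Real.exp (-(c * K ^ 2))) := by
  have hPle : ∀ x, P x ≤ 1 := fun x =>
    hP1 ▸ Finset.single_le_sum (fun y _ => (hP y).le) (Finset.mem_univ x)
  obtain ⟨C₀, hC₀, c, hc, hc2, H₀⟩ := countWeight_sub_gaussian_le hP hP1
  -- Half of the rate `c` produces the factor `exp (-(c/2) K²)`, the other half keeps the sum
  -- convergent.
  obtain ⟨J, hJ, C₂, hC₂, H₂⟩ := gaussian_coset_sum hP hPle hS (b := c / 2) (by positivity)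
  refine ⟨(1 + C₀) * (J + C₂), by positivity, c / 2, by positivity, fun n N K hn hNn hK => ?_⟩
  have hn1 : (1 : ℝ) ≤ n := by exact_mod_cast Nat.one_le_iff_ne_zero.2 hn
  have ht : 1 ≤ √(n : ℝ) := Real.one_le_sqrt.2 hn1
  have ht0 : 0 < √(n : ℝ) := one_pos.trans_le ht
  set T := S.map (whiten P)
  obtain ⟨hs₂, h₂⟩ := H₂ n N (scaledDeviation P n N - T.starProjection (scaledDeviation P n N))
    (T.starProjection (scaledDeviation P n N)) hn (by abel)
    (Submodule.starProjection_apply_mem _ _) (Submodule.sub_starProjection_mem_orthogonal _)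
  set m := scaledDeviation P n N - T.starProjection (scaledDeviation P n N)
  have hterm : ∀ z : integerVectors S, (if K < ‖scaledDeviation P n (N + z)‖ then
      countWeight P n (N + z) else 0) ≤ (1 + C₀) * Real.exp (-(c / 2 * K ^ 2)) *
        Real.exp (-(c / 2 * ‖scaledDeviation P n (N + z)‖ ^ 2)) := by
    intro z
    split_ifs with hz
    · have h3 := H₀ n (N + z) hn (by exact_mod_cast sum_add_integerVectors hS0 hNn z)
      set w := ‖scaledDeviation P n (N + z)‖
      have h4 := (abs_le.1 h3).2
      have h5 : Real.exp (-(w ^ 2 / 2)) ≤ Real.exp (-(c * w ^ 2)) := by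
        apply Real.exp_le_exp.2; nlinarith [sq_nonneg w]
      have h6 : C₀ / √n * Real.exp (-(c * w ^ 2)) ≤ C₀ * Real.exp (-(c * w ^ 2)) := by
        have := div_le_self hC₀ ht
        gcongr
      have h7 : Real.exp (-(c * w ^ 2)) ≤
          Real.exp (-(c / 2 * K ^ 2)) * Real.exp (-(c / 2 * w ^ 2)) := by
        rw [← Real.exp_add]
        apply Real.exp_le_exp.2
        have : K ^ 2 ≤ w ^ 2 := by gcongr
        nlinarith
      calc countWeight P n (N + z) ≤ (1 + C₀) * Real.exp (-(c * w ^ 2)) := by linarith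
        _ ≤ (1 + C₀) * (Real.exp (-(c / 2 * K ^ 2)) * Real.exp (-(c / 2 * w ^ 2))) := by gcongr
        _ = _ := by ring
    · positivity
  have hnonneg : ∀ z : integerVectors S, 0 ≤ (if K < ‖scaledDeviation P n (N + z)‖ then
      countWeight P n (N + z) else 0) := fun z => by
    split_ifs
    · exact countWeight_nonneg hP hn _
    · exact le_rfl
  have hsum := Summable.of_nonneg_of_le hnonneg hterm (hs₂.mul_left _)
  have hexp : Real.exp (-(c / 2 * ‖m‖ ^ 2)) ≤ 1 := by
    rw [Real.exp_le_one_iff]; have := mul_nonneg hc.le (sq_nonneg ‖m‖); linarith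
  have h8 : ∑' z : integerVectors S, Real.exp (-(c / 2 * ‖scaledDeviation P n (N + z)‖ ^ 2)) ≤
      √n ^ finrank ℝ S * (J + C₂) := by
    have h5 : √n ^ finrank ℝ S * (J * Real.exp (-(c / 2 * ‖m‖ ^ 2))) ≤
        √n ^ finrank ℝ S * (J * 1) := by gcongr
    have h6 : √n ^ finrank ℝ S * (C₂ / √n * Real.exp (-(c / 2 * ‖m‖ ^ 2))) ≤
        √n ^ finrank ℝ S * (C₂ * 1) := by
      have := div_le_self hC₂ ht
      gcongr
    linarith [(abs_le.1 h₂).2]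
  calc _ ≤ ∑' z : integerVectors S, (1 + C₀) * Real.exp (-(c / 2 * K ^ 2)) *
        Real.exp (-(c / 2 * ‖scaledDeviation P n (N + z)‖ ^ 2)) :=
        hsum.tsum_le_tsum hterm (hs₂.mul_left _)
    _ ≤ (1 + C₀) * Real.exp (-(c / 2 * K ^ 2)) * (√n ^ finrank ℝ S * (J + C₂)) := by
        rw [tsum_mul_left]; gcongr
    _ = _ := by ring

end

section

set_option linter.unusedSectionVars false

/-! ### The law of the vector of counts -/

variable {𝒳 : Type*} [Fintype 𝒳] [DecidableEq 𝒳] {Ω : Type*}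

/-- The vector of counts of the first `n` observations. -/
def counts (X : ℕ → Ω → 𝒳) (n : ℕ) (ω : Ω) : 𝒳 → ℕ :=
  fun x => ∑ i ∈ Finset.range n, if X i ω = x then 1 else 0

theorem sum_counts (X : ℕ → Ω → 𝒳) (n : ℕ) (ω : Ω) : ∑ x, counts X n ω x = n := by
  simp only [counts]
  rw [Finset.sum_comm]
  simp

theorem counts_succ (X : ℕ → Ω → 𝒳) (n : ℕ) (ω : Ω) :
    counts X (n + 1) ω = counts X n ω + Pi.single (X n ω) 1 := by
  ext x
  simp only [counts, Finset.sum_range_succ, Pi.add_apply, Pi.single_apply, @eq_comm _ x]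

theorem empiricalType_eq (X : ℕ → Ω → 𝒳) (n : ℕ) (ω : Ω) :
    empiricalType X n ω = fun x => (n : ℝ)⁻¹ * counts X n ω x := by
  ext x
  simp [empiricalType, counts]

theorem momentMap_apply {q : ℕ} (f : 𝒳 → Fin q → ℝ) (v : 𝒳 → ℝ) :
    momentMap f v = ∑ x, v x • f x := by
  ext j
  simp [momentMap, Matrix.mulVec, dotProduct, mul_comm]

theorem sampleMoment_eq {q : ℕ} (X : ℕ → Ω → 𝒳) (f : 𝒳 → Fin q → ℝ) (n : ℕ) (ω : Ω) :
    sampleMoment X f n ω = (n : ℝ)⁻¹ • momentMap f (fun x => counts X n ω x) := by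
  rw [sampleMoment, momentMap_apply]
  congr 1
  simp only [counts, Nat.cast_sum, Nat.cast_ite, Nat.cast_one, Nat.cast_zero, Finset.sum_smul,
    ite_smul, one_smul, zero_smul]
  rw [Finset.sum_comm]
  simp

variable [MeasurableSpace 𝒳] [MeasurableSingletonClass 𝒳] [MeasurableSpace Ω]

theorem measurable_counts {X : ℕ → Ω → 𝒳} (hX : ∀ i, Measurable (X i)) (n : ℕ) :
    Measurable (counts X n) := by
  refine measurable_pi_lambda _ fun x => Finset.measurable_sum _ fun i _ => ?_
  exact Measurable.ite (hX i (measurableSet_singleton x)) measurable_const measurable_const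

theorem measure_inter_counts {μ : Measure Ω} [IsProbabilityMeasure μ] {X : ℕ → Ω → 𝒳}
    (hX : ∀ i, Measurable (X i)) (hindep : iIndepFun X μ) (n : ℕ) (x : 𝒳) (k : 𝒳 → ℕ) :
    μ.real ({ω | X n ω = x} ∩ {ω | counts X n ω = k}) =
      μ.real {ω | X n ω = x} * μ.real {ω | counts X n ω = k} := by
  have h := hindep.indepFun_finset {n} (Finset.range n) (by simp) hX
  have h1 : Measurable fun y : ({n} : Finset ℕ) → 𝒳 => y ⟨n, by simp⟩ := measurable_pi_apply _
  have h2 : Measurable fun y : Finset.range n → 𝒳 =>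
      (fun x => ∑ i : Finset.range n, if y i = x then 1 else 0 : 𝒳 → ℕ) := by
    refine measurable_pi_lambda _ fun x => Finset.measurable_sum _ fun i _ => ?_
    exact Measurable.ite ((measurable_pi_apply (X := fun _ : Finset.range n => 𝒳) i)
      (measurableSet_singleton x)) measurable_const measurable_const
  have h3 := h.comp h1 h2
  have h4 : (fun y : Finset.range n → 𝒳 =>
      (fun x => ∑ i : Finset.range n, if y i = x then 1 else 0 : 𝒳 → ℕ)) ∘
      (fun a (i : Finset.range n) => X i a) = counts X n := by
    ext ω x
    simp only [Function.comp, counts]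
    exact Finset.sum_coe_sort (Finset.range n) (fun i => if X i ω = x then 1 else 0)
  rw [h4] at h3
  have h5 := h3.measure_inter_preimage_eq_mul {x} {k} (measurableSet_singleton x)
    (measurableSet_singleton k)
  have h6 := congrArg ENNReal.toReal h5
  rw [ENNReal.toReal_mul] at h6
  exact h6

/-- The counts of independent observations have a multinomial law. -/
theorem measure_counts_eq {μ : Measure Ω} [IsProbabilityMeasure μ] {Q : 𝒳 → ℝ} {X : ℕ → Ω → 𝒳}
    (hX : ∀ i, Measurable (X i)) (hindep : iIndepFun X μ)
    (hlaw : ∀ i x, μ.real {ω | X i ω = x} = Q x) (n : ℕ) (k : 𝒳 → ℕ) (hk : ∑ x, k x = n) :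
    μ.real {ω | counts X n ω = k} = n.factorial * ∏ x, (Q x ^ k x / (k x).factorial) := by
  induction n generalizing k with
  | zero =>
    have hk0 : k = 0 := by
      ext x
      exact (Finset.sum_eq_zero_iff.1 hk) x (Finset.mem_univ x)
    subst hk0
    have : {ω | counts X 0 ω = 0} = Set.univ := by
      ext ω
      simp only [Set.mem_ofPred_eq, Set.mem_univ, iff_true]
      ext x
      simp [counts]
    rw [this]
    simp
  | succ n ih =>
    have hunion : {ω | counts X (n + 1) ω = k} =
        ⋃ x ∈ (Finset.univ : Finset 𝒳), {ω | X n ω = x} ∩ {ω | counts X n ω + Pi.single x 1 = k} := by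
      ext ω
      simp [counts_succ]
    have hmeas : ∀ x, MeasurableSet
        ({ω | X n ω = x} ∩ {ω | counts X n ω + Pi.single x 1 = k}) := fun x =>
      (hX n (measurableSet_singleton x)).inter
        ((measurable_counts hX n).add_const _ (measurableSet_singleton k))
    rw [hunion, measureReal_biUnion_finset (fun x _ y _ hxy => Set.disjoint_left.2
      fun ω hω hω' => hxy (hω.1.symm.trans hω'.1)) fun x _ => hmeas x]
    -- Decomposition by the last observation: the value `x` contributes in proportion to `k x`, and
    -- `∑ k x = n + 1` turns `n!` into `(n + 1)!`. For `k x = 0` the event is empty, in agreement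
    -- with the factor.
    have hterm : ∀ x, μ.real ({ω | X n ω = x} ∩ {ω | counts X n ω + Pi.single x 1 = k}) =
        n.factorial * (∏ y, (Q y ^ k y / (k y).factorial)) * k x := by
      intro x
      rcases Nat.eq_zero_or_pos (k x) with hx | hx
      · have : {ω | X n ω = x} ∩ {ω | counts X n ω + Pi.single x 1 = k} = ∅ := by
          ext ω
          simp only [Set.mem_inter_iff, Set.mem_ofPred_eq, Set.mem_empty_iff_false, iff_false]
          rintro ⟨-, h⟩
          have := congrFun h x
          simp [hx] at this
        rw [this, hx]
        simp
      · set k' : 𝒳 → ℕ := Function.update k x (k x - 1) with hk'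
        have hkk : k' + Pi.single x 1 = k := by
          ext y
          rcases eq_or_ne y x with rfl | hy
          · simp [hk', Nat.sub_add_cancel hx]
          · simp [hk', hy]
        have hset : {ω | counts X n ω + Pi.single x 1 = k} = {ω | counts X n ω = k'} := by
          ext ω
          simp only [Set.mem_ofPred_eq]
          rw [← hkk, add_left_inj]
        have hsum : ∑ y, k' y = n := by
          have : ∑ y, (k' y + (Pi.single x 1 : 𝒳 → ℕ) y) = n + 1 := by
            rw [← hk, ← hkk]; rfl
          rw [Finset.sum_add_distrib] at this
          simpa using this
        rw [hset, measure_inter_counts hX hindep, hlaw, ih k' hsum]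
        have h1 := Finset.mul_prod_erase Finset.univ
          (fun y => Q y ^ k' y / ((k' y).factorial : ℝ)) (Finset.mem_univ x)
        have h2 := Finset.mul_prod_erase Finset.univ
          (fun y => Q y ^ k y / ((k y).factorial : ℝ)) (Finset.mem_univ x)
        have h3 : ∏ y ∈ Finset.univ.erase x, Q y ^ k' y / ((k' y).factorial : ℝ) =
            ∏ y ∈ Finset.univ.erase x, Q y ^ k y / ((k y).factorial : ℝ) := by
          refine Finset.prod_congr rfl fun y hy => ?_
          rw [hk', Function.update_of_ne (Finset.ne_of_mem_erase hy)]
        rw [← h1, ← h2, h3]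
        have h4 : k' x = k x - 1 := by simp [hk']
        obtain ⟨j, hj⟩ := Nat.exists_eq_succ_of_ne_zero hx.ne'
        simp only [h4, hj, Nat.succ_eq_add_one, Nat.add_sub_cancel, Nat.factorial_succ]
        push_cast
        field_simp
        ring
    simp only [hterm]
    rw [← Finset.mul_sum]
    have : ∑ x, (k x : ℝ) = n + 1 := by exact_mod_cast hk
    rw [this, Nat.factorial_succ]
    push_cast
    ring

end

section

/-! ### The information projection -/

variable {𝒳 : Type*} [Fintype 𝒳] {Ω : Type*}

theorem add_mem_constraintSet {d : ℕ} {h : 𝒳 → Fin d → ℝ} {a : Fin d → ℝ} {P v : 𝒳 → ℝ}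
    (hP : P ∈ constraintSet h a) (hv : v ∈ tangentSpace h) (hpos : ∀ x, 0 < P x + v x) :
    P + v ∈ constraintSet h a := by
  refine ⟨⟨hpos, ?_⟩, ?_⟩
  · have h1 := hP.1.2
    have h2 := hv.1
    simp [Finset.sum_add_distrib, h1, h2]
  · rw [map_add, hP.2, hv.2, add_zero]

theorem sub_mem_tangentSpace {d : ℕ} {h : 𝒳 → Fin d → ℝ} {a : Fin d → ℝ} {P R : 𝒳 → ℝ}
    (hP : P ∈ constraintSet h a) (hR : R ∈ constraintSet h a) : R - P ∈ tangentSpace h := by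
  refine ⟨?_, ?_⟩
  · have h1 := hP.1.2
    have h2 := hR.1.2
    simp [Finset.sum_sub_distrib, h1, h2]
  · rw [map_sub, hP.2, hR.2, sub_self]

/-- The logarithm of the density of the information projection is orthogonal to the tangent
space. -/
theorem sum_mul_log_eq_zero {d : ℕ} {h : 𝒳 → Fin d → ℝ} {a : Fin d → ℝ} {P Q v : 𝒳 → ℝ}
    (hQ : ∀ x, 0 < Q x) (hP : IsInformationProjection Q (constraintSet h a) P)
    (hv : v ∈ tangentSpace h) : ∑ x, v x * Real.log (P x / Q x) = 0 := by
  have hpos := hP.1.1.1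
  have hev : ∀ᶠ t : ℝ in nhds 0, ∀ x, 0 < P x + t * v x := by
    rw [Filter.eventually_all]
    intro x
    have hc : ContinuousAt (fun t : ℝ => P x + t * v x) 0 := by fun_prop
    exact hc.eventually (lt_mem_nhds (by simpa using hpos x))
  -- Positivity of `P` allows small moves along both `v` and `-v`, so minimality gives a vanishing
  -- derivative and not merely an inequality.
  have hmin : IsLocalMin (fun t : ℝ => klDivergence (P + t • v) Q) 0 := by
    filter_upwards [hev] with t ht
    simp only [zero_smul, add_zero]
    exact hP.2 _ (add_mem_constraintSet hP.1 (Submodule.smul_mem _ t hv) ht)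
  have hder : HasDerivAt (fun t : ℝ => klDivergence (P + t • v) Q)
      (∑ x, (v x * Real.log (P x / Q x) + v x)) 0 := by
    simp only [klDivergence]
    refine HasDerivAt.fun_sum fun x _ => ?_
    have h1 : HasDerivAt (fun t : ℝ => (P + t • v) x) (v x) 0 := by
      simpa using ((hasDerivAt_id (0 : ℝ)).mul_const (v x)).const_add (P x)
    have h2 := h1.mul ((h1.div_const (Q x)).log (by
      simpa using div_ne_zero (hpos x).ne' (hQ x).ne'))
    convert! h2 using 1
    have := (hpos x).ne'
    have := (hQ x).ne'
    simp
    field_simp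
  have h0 := hmin.hasDerivAt_eq_zero hder
  rw [Finset.sum_add_distrib, hv.1, add_zero] at h0
  exact h0

variable [DecidableEq 𝒳]

theorem empiricalType_mem_iff {d : ℕ} {h : 𝒳 → Fin d → ℝ} {a : Fin d → ℝ} {P : 𝒳 → ℝ}
    (hP : P ∈ constraintSet h a) (X : ℕ → Ω → 𝒳) {n : ℕ} (hn : n ≠ 0) (ω : Ω) :
    empiricalType X n ω ∈ constraintSet h a ↔ (∀ x, 0 < counts X n ω x) ∧
      (fun x => (counts X n ω x : ℝ) - n * P x) ∈ tangentSpace h := by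
  have hn0 : (n : ℝ) ≠ 0 := by exact_mod_cast hn
  have hn1 : (0 : ℝ) < n := by positivity
  have hsmul : (fun x => (counts X n ω x : ℝ) - n * P x) =
      (n : ℝ) • (empiricalType X n ω - P) := by
    rw [empiricalType_eq]
    ext x
    simp only [Pi.smul_apply, Pi.sub_apply, smul_eq_mul]
    field_simp
  have hpos : ∀ x, 0 < empiricalType X n ω x ↔ 0 < counts X n ω x := fun x => by
    rw [empiricalType_eq]
    simp only [inv_pos.2 hn1, mul_pos_iff_of_pos_left, Nat.cast_pos]
  constructor
  · intro hmem
    refine ⟨fun x => (hpos x).1 (hmem.1.1 x), ?_⟩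
    rw [hsmul]
    exact Submodule.smul_mem _ _ (sub_mem_tangentSpace hP hmem)
  · rintro ⟨h1, h2⟩
    rw [hsmul] at h2
    have h3 : empiricalType X n ω - P ∈ tangentSpace h := by
      have := Submodule.smul_mem _ (n : ℝ)⁻¹ h2
      rwa [smul_smul, inv_mul_cancel₀ hn0, one_smul] at this
    have h4 := add_mem_constraintSet hP h3 fun x => by
      rw [Pi.sub_apply, add_sub_cancel]
      exact (hpos x).2 (h1 x)
    rwa [add_sub_cancel] at h4

variable [MeasurableSpace 𝒳] [MeasurableSingletonClass 𝒳] [MeasurableSpace Ω]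

/-- Up to a constant factor, the law of the counts on the constraint set is that of independent
draws from the information projection. -/
theorem exists_measure_counts_eq {μ : Measure Ω} [IsProbabilityMeasure μ] {P Q : 𝒳 → ℝ}
    {X : ℕ → Ω → 𝒳} (hX : ∀ i, Measurable (X i)) (hindep : iIndepFun X μ)
    (hQ : ∀ x, 0 < Q x) (hlaw : ∀ i x, μ.real {ω | X i ω = x} = Q x)
    {d : ℕ} {h : 𝒳 → Fin d → ℝ} {a : Fin d → ℝ}
    (hP : IsInformationProjection Q (constraintSet h a) P) {n : ℕ} (hn : n ≠ 0) :
    ∃ K : ℝ, 0 < K ∧ ∀ N : 𝒳 → ℤ, (∀ x, 0 < N x) →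
      (fun x => (N x : ℝ) - n * P x) ∈ tangentSpace h →
      μ.real {ω | (fun x => (counts X n ω x : ℤ)) = N} = K * countWeight P n N := by
  have hn1 : (0 : ℝ) < n := by positivity
  have hpos := hP.1.1.1
  set c := ∏ x, √(2 * Real.pi * (n * P x)) * Real.exp (-(n * P x)) with hc
  have hcpos : 0 < c := Finset.prod_pos fun x _ => by
    have := hpos x
    have := Real.pi_pos
    positivity
  set κ := ∑ x, n * P x * Real.log (P x / Q x) with hκ
  -- `n!` comes from the multinomial coefficient, `exp (-κ)` from the change of measure from `P` to
  -- `Q`, and `c * n ^ n` undoes the normalization of the Poisson weights.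
  refine ⟨n.factorial * Real.exp (-κ) / (c * n ^ n), by positivity, fun N hN hmem => ?_⟩
  obtain ⟨k, rfl⟩ : ∃ k : 𝒳 → ℕ, N = fun x => (k x : ℤ) :=
    ⟨fun x => (N x).toNat, funext fun x => (Int.toNat_of_nonneg (hN x).le).symm⟩
  simp only [Int.cast_natCast] at hmem
  have hset : {ω | (fun x => (counts X n ω x : ℤ)) = fun x => (k x : ℤ)} =
      {ω | counts X n ω = k} := by
    ext ω
    simp [funext_iff]
  have hsum : ∑ x, k x = n := by
    have h1 := hmem.1
    rw [Finset.sum_sub_distrib, ← Finset.mul_sum, hP.1.1.2, mul_one, sub_eq_zero] at h1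
    exact_mod_cast h1
  rw [hset, measure_counts_eq hX hindep hlaw n k hsum, countWeight, if_pos hN]
  -- The log-likelihood ratio is the same for all admissible counts, since `k - n P` is tangent and
  -- hence orthogonal to `log (P/Q)`.
  have hlog : ∑ x, (k x : ℝ) * Real.log (P x / Q x) = κ := by
    have h1 := sum_mul_log_eq_zero hQ hP hmem
    simp only [sub_mul, Finset.sum_sub_distrib] at h1
    rw [hκ]
    linarith
  have htilt : ∏ x, Q x ^ k x = Real.exp (-κ) * ∏ x, P x ^ k x := by
    rw [← hlog, ← Finset.sum_neg_distrib, Real.exp_sum, ← Finset.prod_mul_distrib]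
    refine Finset.prod_congr rfl fun x _ => ?_
    have h1 := hpos x
    have h2 := hQ x
    have h3 : Real.exp (-((k x : ℝ) * Real.log (P x / Q x))) = (Q x / P x) ^ k x := by
      rw [← mul_neg, ← Real.log_inv, inv_div, mul_comm, Real.exp_mul, Real.exp_log (by positivity),
        Real.rpow_natCast]
    rw [h3, ← mul_pow, div_mul_cancel₀ _ h1.ne']
  have hpois : ∏ x, poissonTerm (n * P x) (k x) =
      c * n ^ n * ∏ x, (P x ^ k x / (k x).factorial) := by
    have h1 : (n : ℝ) ^ n = ∏ x, (n : ℝ) ^ k x := by rw [Finset.prod_pow_eq_pow_sum, hsum]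
    rw [h1, hc, ← Finset.prod_mul_distrib, ← Finset.prod_mul_distrib]
    refine Finset.prod_congr rfl fun x _ => ?_
    rw [poissonTerm, mul_pow]
    ring
  simp only [Int.toNat_natCast]
  rw [hpois, Finset.prod_div_distrib, Finset.prod_div_distrib, htilt]
  field_simp

/-- The probability that the empirical type satisfies the constraint, the counts belong to the
coset of `N` and have the property `B`, as a sum of count weights. -/
theorem exists_measure_coset_eq {μ : Measure Ω} [IsProbabilityMeasure μ] {P Q : 𝒳 → ℝ}
    {X : ℕ → Ω → 𝒳} (hX : ∀ i, Measurable (X i)) (hindep : iIndepFun X μ)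
    (hQ : ∀ x, 0 < Q x) (hlaw : ∀ i x, μ.real {ω | X i ω = x} = Q x)
    {d : ℕ} {h : 𝒳 → Fin d → ℝ} {a : Fin d → ℝ}
    (hP : IsInformationProjection Q (constraintSet h a) P) {n : ℕ} (hn : n ≠ 0) :
    ∃ K : ℝ, 0 < K ∧ ∀ (S : Submodule ℝ (𝒳 → ℝ)) (N : 𝒳 → ℤ) (B : (𝒳 → ℤ) → Prop)
      [DecidablePred B], S ≤ tangentSpace h → (fun x => (N x : ℝ) - n * P x) ∈ tangentSpace h →
      μ.real {ω | empiricalType X n ω ∈ constraintSet h a ∧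
        (fun x => (counts X n ω x : ℝ) - N x) ∈ S ∧ B fun x => (counts X n ω x : ℤ)} =
      K * ∑' z : integerVectors S, if B (N + z) then countWeight P n (N + z) else 0 := by
  obtain ⟨K, hK, H⟩ := exists_measure_counts_eq hX hindep hQ hlaw hP hn
  refine ⟨K, hK, fun S N B _ hS hN => ?_⟩
  set A := {ω | empiricalType X n ω ∈ constraintSet h a ∧
        (fun x => (counts X n ω x : ℝ) - N x) ∈ S ∧ B fun x => (counts X n ω x : ℤ)} with hA
  have hunion : A = ⋃ z : integerVectors S, A ∩ {ω | (fun x => (counts X n ω x : ℤ)) = N + z} := by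
    rw [← Set.inter_iUnion, eq_comm, Set.inter_eq_left]
    rintro ω ⟨-, hω, -⟩
    refine Set.mem_iUnion.2 ⟨⟨fun x => (counts X n ω x : ℤ) - N x, ?_⟩, ?_⟩
    · rw [mem_integerVectors]
      simpa using hω
    · ext x
      simp
  have hmem : ∀ z : integerVectors S, (fun x => ((N + z.1) x : ℝ) - n * P x) ∈ tangentSpace h := by
    intro z
    have := Submodule.add_mem _ hN (hS (mem_integerVectors.1 z.2))
    convert! this using 1
    ext x
    simp
    ring
  -- A lattice point of the coset either is a possible vector of counts satisfying `B`, or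
  -- contributes zero on both sides: the event is empty, and either the indicator of `B` or the
  -- count weight vanishes.
  have hcase : ∀ z : integerVectors S,
      ((∀ x, 0 < (N + z.1) x) ∧ B (N + z) ∧
        A ∩ {ω | (fun x => (counts X n ω x : ℤ)) = N + z} =
          {ω | (fun x => (counts X n ω x : ℤ)) = N + z}) ∨
      (¬ ((∀ x, 0 < (N + z.1) x) ∧ B (N + z)) ∧
        A ∩ {ω | (fun x => (counts X n ω x : ℤ)) = N + z} = ∅) := by
    intro z
    by_cases hz : (∀ x, 0 < (N + z.1) x) ∧ B (N + z)
    · refine Or.inl ⟨hz.1, hz.2, Set.inter_eq_right.2 fun ω hω => ?_⟩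
      have hω' : ∀ x, (counts X n ω x : ℤ) = (N + z.1) x := congrFun hω
      have hωr : ∀ x, (counts X n ω x : ℝ) = ((N + z.1) x : ℤ) := fun x => by
        rw [← hω' x]; simp
      refine ⟨(empiricalType_mem_iff hP.1 X hn ω).2 ⟨fun x => ?_, ?_⟩, ?_, ?_⟩
      · have := hz.1 x
        rw [← hω' x] at this
        exact_mod_cast this
      · simpa only [hωr] using hmem z
      · simp only [hωr]
        convert! mem_integerVectors.1 z.2 using 1
        ext x
        simp
      · have : (fun x => (counts X n ω x : ℤ)) = N + z.1 := hω
        rw [this]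
        exact hz.2
    · refine Or.inr ⟨hz, ?_⟩
      ext ω
      simp only [Set.mem_inter_iff, Set.mem_empty_iff_false, iff_false]
      rintro ⟨⟨h1, -, h3⟩, h4⟩
      have hω : (fun x => (counts X n ω x : ℤ)) = N + z.1 := h4
      refine hz ⟨fun x => ?_, hω ▸ h3⟩
      rw [← hω]
      exact Int.natCast_pos.2 (((empiricalType_mem_iff hP.1 X hn ω).1 h1).1 x)
  have hmeas0 : ∀ M : 𝒳 → ℤ, MeasurableSet {ω | (fun x => (counts X n ω x : ℤ)) = M} := fun M =>
    ((measurable_of_countable fun k : 𝒳 → ℕ => (fun x => (k x : ℤ))).comp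
      (measurable_counts hX n)) (measurableSet_singleton M)
  have hmeas : ∀ z : integerVectors S,
      MeasurableSet (A ∩ {ω | (fun x => (counts X n ω x : ℤ)) = N + z}) := fun z => by
    rcases hcase z with ⟨-, -, h1⟩ | ⟨-, h1⟩ <;> rw [h1]
    · exact hmeas0 _
    · exact MeasurableSet.empty
  have hdisj : Pairwise (Function.onFun Disjoint fun z : integerVectors S =>
      A ∩ {ω | (fun x => (counts X n ω x : ℤ)) = N + z}) := by
    intro z y hzy
    refine Set.disjoint_left.2 fun ω hω hω' => hzy ?_
    have := (show _ = _ from hω.2).symm.trans hω'.2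
    exact Subtype.ext (add_left_cancel this)
  rw [← tsum_mul_left, hunion, measureReal_def, measure_iUnion hdisj hmeas,
    ENNReal.tsum_toReal_eq fun _ => measure_ne_top _ _]
  refine tsum_congr fun z => ?_
  rcases hcase z with ⟨h1, h2, h3⟩ | ⟨h1, h3⟩ <;> rw [h3]
  · rw [if_pos h2]
    exact H _ h1 (hmem z)
  · rw [measure_empty, ENNReal.toReal_zero]
    split_ifs with h4
    · rw [countWeight, if_neg fun h5 => h1 ⟨h5, h4⟩, mul_zero]
    · rw [mul_zero]

end

section

/-! ### The metric induced on moment space -/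

variable {𝒳 : Type*} [Fintype 𝒳] {q r : ℕ}

theorem restrictedMoment_mulVec (f : 𝒳 → Fin q → ℝ) (V : Matrix 𝒳 (Fin r) ℝ) (c : Fin r → ℝ) :
    restrictedMoment f V *ᵥ c = momentMap f (V *ᵥ c) := by
  simp [restrictedMoment, momentMap, Matrix.mulVec_mulVec]

theorem IsOrthonormalBasisOf.injective {V : Matrix 𝒳 (Fin r) ℝ} {T : Submodule ℝ (𝒳 → ℝ)}
    (hV : IsOrthonormalBasisOf V T) : Function.Injective V.mulVec := by
  intro c e hce
  have h1 := congrArg (fun w => Vᵀ *ᵥ w) hce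
  simpa [Matrix.mulVec_mulVec, hV.1] using h1

theorem IsOrthonormalBasisOf.exists_mulVec {V : Matrix 𝒳 (Fin r) ℝ} {T : Submodule ℝ (𝒳 → ℝ)}
    (hV : IsOrthonormalBasisOf V T) {v : 𝒳 → ℝ} (hv : v ∈ T) : ∃ c, V *ᵥ c = v := by
  rw [← hV.2] at hv
  exact hv

theorem IsOrthonormalBasisOf.mulVec_mem {V : Matrix 𝒳 (Fin r) ℝ} {T : Submodule ℝ (𝒳 → ℝ)}
    (hV : IsOrthonormalBasisOf V T) (c : Fin r → ℝ) : V *ᵥ c ∈ T := by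
  rw [← hV.2]
  exact ⟨c, rfl⟩

variable [DecidableEq 𝒳]

theorem dotProduct_projectedHessian_mulVec (V : Matrix 𝒳 (Fin r) ℝ) (P : 𝒳 → ℝ)
    (c : Fin r → ℝ) :
    c ⬝ᵥ (projectedHessian V P *ᵥ c) = ∑ x, (V *ᵥ c) x ^ 2 / P x := by
  rw [projectedHessian, ← Matrix.mulVec_mulVec, ← Matrix.mulVec_mulVec, Matrix.dotProduct_mulVec,
    Matrix.vecMul_transpose]
  simp only [dotProduct, Matrix.mulVec_diagonal]
  refine Finset.sum_congr rfl fun x _ => ?_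
  ring

theorem posDef_projectedHessian {V : Matrix 𝒳 (Fin r) ℝ} {T : Submodule ℝ (𝒳 → ℝ)}
    (hV : IsOrthonormalBasisOf V T) {P : 𝒳 → ℝ} (hP : ∀ x, 0 < P x) :
    (projectedHessian V P).PosDef := by
  have h1 : (Matrix.diagonal fun x => 1 / P x).PosDef :=
    Matrix.PosDef.diagonal fun x => one_div_pos.2 (hP x)
  have h2 := h1.conjTranspose_mul_mul_same hV.injective
  rwa [Matrix.conjTranspose_eq_transpose_of_trivial] at h2

theorem posDef_pushforwardMetric {V : Matrix 𝒳 (Fin r) ℝ} {T : Submodule ℝ (𝒳 → ℝ)}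
    (hV : IsOrthonormalBasisOf V T) {P : 𝒳 → ℝ} (hP : ∀ x, 0 < P x) {f : 𝒳 → Fin q → ℝ}
    (hf : T.map (momentMap f) = ⊤) : (pushforwardMetric f V P).PosDef := by
  have h1 := (posDef_projectedHessian hV hP).inv
  have hinj : Function.Injective (restrictedMoment f V).vecMul := by
    intro y w hyw
    refine dotProduct_eq _ _ fun u => ?_
    have hu : u ∈ T.map (momentMap f) := hf ▸ Submodule.mem_top
    obtain ⟨v, hv, rfl⟩ := hu
    obtain ⟨c, rfl⟩ := hV.exists_mulVec hv
    rw [← restrictedMoment_mulVec, Matrix.dotProduct_mulVec, Matrix.dotProduct_mulVec]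
    exact congrArg (· ⬝ᵥ c) hyw
  have h2 := h1.mul_mul_conjTranspose_same hinj
  rwa [Matrix.conjTranspose_eq_transpose_of_trivial] at h2

/-- The weight is the quotient metric of the information metric under the moment map. -/
theorem isLeast_optimalWeight {V : Matrix 𝒳 (Fin r) ℝ} {T : Submodule ℝ (𝒳 → ℝ)}
    (hV : IsOrthonormalBasisOf V T) {P : 𝒳 → ℝ} (hP : ∀ x, 0 < P x) {f : 𝒳 → Fin q → ℝ}
    (hf : T.map (momentMap f) = ⊤) (u : Fin q → ℝ) :
    IsLeast {e : ℝ | ∃ v ∈ T, momentMap f v = u ∧ e = ∑ x, v x ^ 2 / P x}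
      (u ⬝ᵥ (optimalWeight f V P *ᵥ u)) := by
  have hH := posDef_projectedHessian hV hP
  have hG := posDef_pushforwardMetric hV hP hf
  have hHdet := (Matrix.isUnit_iff_isUnit_det _).1 hH.isUnit
  have hGdet := (Matrix.isUnit_iff_isUnit_det _).1 hG.isUnit
  set H := projectedHessian V P with hHdef
  set M := restrictedMoment f V with hM
  have hHsymm : Hᵀ = H := by
    have := hH.isHermitian
    rwa [Matrix.IsHermitian, Matrix.conjTranspose_eq_transpose_of_trivial] at this
  set y := optimalWeight f V P *ᵥ u with hy
  -- The minimizer by Lagrange multipliers, with `y` the multiplier of the constraint `M c = u`.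
  set c := H⁻¹ *ᵥ (Mᵀ *ᵥ y) with hc
  have hHc : H *ᵥ c = Mᵀ *ᵥ y := by
    rw [hc, Matrix.mulVec_mulVec, Matrix.mul_nonsing_inv _ hHdet, Matrix.one_mulVec]
  have hMc : M *ᵥ c = u := by
    rw [hc, Matrix.mulVec_mulVec, Matrix.mulVec_mulVec]
    change pushforwardMetric f V P *ᵥ (optimalWeight f V P *ᵥ u) = u
    rw [optimalWeight, Matrix.mulVec_mulVec, Matrix.mul_nonsing_inv _ hGdet, Matrix.one_mulVec]
  have hval : ∀ e : Fin r → ℝ, e ⬝ᵥ (H *ᵥ c) = (M *ᵥ e) ⬝ᵥ y := fun e => by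
    rw [hHc, Matrix.dotProduct_mulVec, Matrix.vecMul_transpose]
  constructor
  · refine ⟨V *ᵥ c, hV.mulVec_mem c, ?_, ?_⟩
    · rw [← restrictedMoment_mulVec, ← hM, hMc]
    · rw [← dotProduct_projectedHessian_mulVec, ← hHdef, hval, hMc]
  · rintro _ ⟨v, hv, hvu, rfl⟩
    obtain ⟨b, rfl⟩ := hV.exists_mulVec hv
    rw [← restrictedMoment_mulVec, ← hM] at hvu
    rw [← dotProduct_projectedHessian_mulVec, ← hHdef]
    have hb : b = c + (b - c) := by abel
    set e := b - c with he
    have hMe : M *ᵥ e = 0 := by rw [he, Matrix.mulVec_sub, hvu, hMc, sub_self]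
    have hsym : c ⬝ᵥ (H *ᵥ e) = e ⬝ᵥ (H *ᵥ c) := by
      -- With this symmetry both cross terms of the expansion below equal `(M e) · y`, which
      -- vanishes because `M e = 0`.
      rw [Matrix.dotProduct_mulVec, ← Matrix.mulVec_transpose, hHsymm, dotProduct_comm]
    rw [hb, Matrix.mulVec_add, add_dotProduct, dotProduct_add, dotProduct_add, hsym, hval, hval,
      hMc, hMe, zero_dotProduct, dotProduct_projectedHessian_mulVec]
    have : 0 ≤ ∑ x, (V *ᵥ e) x ^ 2 / P x :=
      Finset.sum_nonneg fun x _ => div_nonneg (sq_nonneg _) (hP x).le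
    linarith

end

section

open Module

set_option linter.unusedSectionVars false

/-! ### The conditional likelihood -/

theorem abs_log_sub_log_le {a x : ℝ} (ha : 0 < a) (hx : |x - a| ≤ a / 2) :
    |Real.log x - Real.log a| ≤ 2 / a * |x - a| := by
  have h1 : |(x - a) / a| ≤ 1 / 2 := by
    rw [abs_div, abs_of_pos ha, div_le_iff₀ ha]
    linarith
  have h2 := abs_log_le_two_mul h1
  have h3 : 1 + (x - a) / a = x / a := by field_simp; ring
  have hx0 : 0 < x := by linarith [(abs_le.1 hx).1]
  rw [h3, Real.log_div hx0.ne' ha.ne', abs_div, abs_of_pos ha] at h2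
  refine h2.trans (le_of_eq ?_)
  ring

/-- The bound `b ≤ B` keeps the Gaussian value above `δ = I exp (-B/2)`, and away from zero additive
errors of order `1/t` remain of order `1/t` after taking logarithms. -/
theorem exists_abs_log_ratio_le {I C₁ C₂ B : ℝ} (hI : 0 < I) (hC₁ : 0 ≤ C₁) (hC₂ : 0 ≤ C₂)
    (hB : 0 ≤ B) :
    ∃ C : ℝ, ∃ t₀ : ℝ, ∀ t f g b : ℝ, 0 < t → t₀ ≤ t → b ≤ B →
      |f - I * Real.exp (-(b / 2))| ≤ C₁ / t → |g - I| ≤ C₂ / t →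
      |-Real.log (f / g) - b / 2| ≤ C / t := by
  set δ := I * Real.exp (-(B / 2)) with hδ
  have hδpos : 0 < δ := by positivity
  have hδI : δ ≤ I := by
    rw [hδ]
    refine mul_le_of_le_one_right hI.le ?_
    rw [Real.exp_le_one_iff]
    linarith
  refine ⟨2 / δ * C₁ + 2 / δ * C₂, 2 * (C₁ + C₂) / δ, fun t f g b ht ht₀ hb hf hg => ?_⟩
  have hsmall : (C₁ + C₂) / t ≤ δ / 2 := by
    rw [div_le_iff₀ hδpos] at ht₀
    rw [div_le_div_iff₀ ht two_pos]
    linarith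
  rw [add_div] at hsmall
  have h1 : 0 ≤ C₁ / t := by positivity
  have h2 : 0 ≤ C₂ / t := by positivity
  have ha : δ ≤ I * Real.exp (-(b / 2)) := by rw [hδ]; gcongr
  set a := I * Real.exp (-(b / 2)) with hadef
  have hapos : 0 < a := hδpos.trans_le ha
  have hlf := abs_log_sub_log_le hapos (x := f) (by linarith)
  have hlg := abs_log_sub_log_le hI (x := g) (by linarith)
  have hf0 : 0 < f := by linarith [(abs_le.1 hf).1]
  have hg0 : 0 < g := by linarith [(abs_le.1 hg).1]
  have hloga : Real.log a = Real.log I - b / 2 := by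
    rw [hadef, Real.log_mul hI.ne' (Real.exp_pos _).ne', Real.log_exp]
    ring
  rw [Real.log_div hf0.ne' hg0.ne']
  have h3 : -(Real.log f - Real.log g) - b / 2 =
      (Real.log g - Real.log I) - (Real.log f - Real.log a) := by rw [hloga]; ring
  rw [h3]
  have h4 : 2 / a * |f - a| ≤ 2 / δ * (C₁ / t) := by gcongr
  have h5 : 2 / I * |g - I| ≤ 2 / δ * (C₂ / t) := by gcongr
  calc _ ≤ |Real.log g - Real.log I| + |Real.log f - Real.log a| := abs_sub _ _
    _ ≤ 2 / δ * (C₂ / t) + 2 / δ * (C₁ / t) := by linarith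
    _ = _ := by ring

variable {𝒳 : Type*} [Fintype 𝒳] {q : ℕ}

/-- The squared length of the component of the scaled deviation that is normal to the kernel of the
moment map is the squared length of the scaled moment in the quotient metric. -/
theorem isLeast_norm_sq_of_orthogonal {P : 𝒳 → ℝ} (hP : ∀ x, 0 < P x)
    {T : Submodule ℝ (𝒳 → ℝ)} {f : 𝒳 → Fin q → ℝ} (hmoment : momentMap f P = 0) {n : ℕ}
    {N : 𝒳 → ℤ} (hN : (fun x => (N x : ℝ) - n * P x) ∈ T) {m s : EuclideanSpace ℝ 𝒳}
    (hms : scaledDeviation P n N = m + s)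
    (hs : s ∈ (T ⊓ LinearMap.ker (momentMap f)).map (whiten P))
    (hm : m ∈ ((T ⊓ LinearMap.ker (momentMap f)).map (whiten P))ᗮ) :
    IsLeast {e : ℝ | ∃ v ∈ T, momentMap f v = (√n)⁻¹ • momentMap f (fun x => (N x : ℝ)) ∧
      e = ∑ x, v x ^ 2 / P x} (‖m‖ ^ 2) := by
  obtain ⟨w, ⟨hwT, hwker⟩, rfl⟩ := hs
  rw [scaledDeviation_eq] at hms
  set v := (√n)⁻¹ • (fun x => (N x : ℝ) - n * P x) - w with hv
  have hmv : m = whiten P v := by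
    rw [hv, map_sub, map_smul, hms, add_sub_cancel_right]
  have hvT : v ∈ T := T.sub_mem (T.smul_mem _ hN) hwT
  -- The centring `n P` has zero moment and `w` lies in the kernel, so neither changes the moment.
  have hvf : momentMap f v = (√n)⁻¹ • momentMap f (fun x => (N x : ℝ)) := by
    have h1 : (fun x => (N x : ℝ) - n * P x) = (fun x => (N x : ℝ)) - (n : ℝ) • P := rfl
    rw [hv, map_sub, LinearMap.mem_ker.1 hwker, sub_zero, map_smul, h1, map_sub, map_smul, hmoment,
      smul_zero, sub_zero]
  constructor
  · exact ⟨v, hvT, hvf, by rw [hmv, norm_sq_whiten hP]⟩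
  · rintro _ ⟨y, hyT, hyf, rfl⟩
    rw [← norm_sq_whiten hP]
    have hmem : whiten P (y - v) ∈ (T ⊓ LinearMap.ker (momentMap f)).map (whiten P) :=
      ⟨y - v, ⟨T.sub_mem hyT hvT, by
        rw [SetLike.mem_coe, LinearMap.mem_ker, map_sub, hyf, hvf, sub_self]⟩, rfl⟩
    -- Any other lift differs from `v` by a kernel vector, whose whitening is orthogonal to `m`.
    have h2 : whiten P y = m + whiten P (y - v) := by rw [hmv, ← map_add, add_sub_cancel]
    rw [h2, sq, sq, norm_add_sq_eq_norm_sq_add_norm_sq_real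
      (Submodule.inner_left_of_mem_orthogonal hmem hm)]
    nlinarith [norm_nonneg (whiten P (y - v))]

variable [DecidableEq 𝒳] {Ω : Type*} [MeasurableSpace 𝒳] [MeasurableSingletonClass 𝒳]
  [MeasurableSpace Ω]

theorem measurableSet_empiricalType_mem {X : ℕ → Ω → 𝒳} (hX : ∀ i, Measurable (X i)) (n : ℕ)
    (E : Set (𝒳 → ℝ)) : MeasurableSet {ω | empiricalType X n ω ∈ E} := by
  simp only [empiricalType_eq]
  exact measurable_counts hX n
    (MeasurableSet.of_discrete (s := {k : 𝒳 → ℕ | (fun x => (n : ℝ)⁻¹ * (k x : ℝ)) ∈ E}))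

theorem condMomentPMF_eq {μ : Measure Ω} {X : ℕ → Ω → 𝒳} (hX : ∀ i, Measurable (X i))
    (E : Set (𝒳 → ℝ)) (f : 𝒳 → Fin q → ℝ) (n : ℕ) (γ : Fin q → ℝ) :
    condMomentPMF μ X E f n γ = (μ.real {ω | empiricalType X n ω ∈ E})⁻¹ *
      μ.real {ω | empiricalType X n ω ∈ E ∧ sampleMoment X f n ω = γ} := by
  rw [condMomentPMF, condLaw, measureReal_def, cond_apply (measurableSet_empiricalType_mem hX n E),
    ENNReal.toReal_mul, ENNReal.toReal_inv]
  rfl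

/-- Turns the level sets of the sample moment within the constraint event into cosets, to which the
lattice sums apply. -/
theorem sampleMoment_eq_iff {X : ℕ → Ω → 𝒳} {d n : ℕ} (hn : n ≠ 0) {h : 𝒳 → Fin d → ℝ}
    {a : Fin d → ℝ} {P : 𝒳 → ℝ} (hP : P ∈ constraintSet h a) {f : 𝒳 → Fin q → ℝ} {N : 𝒳 → ℤ}
    (hN : (fun x => (N x : ℝ) - n * P x) ∈ tangentSpace h) {ω : Ω}
    (hω : empiricalType X n ω ∈ constraintSet h a) :
    sampleMoment X f n ω = (n : ℝ)⁻¹ • momentMap f (fun x => (N x : ℝ)) ↔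
      (fun x => (counts X n ω x : ℝ) - N x) ∈ tangentSpace h ⊓ LinearMap.ker (momentMap f) := by
  have hn0 : (n : ℝ)⁻¹ ≠ 0 := by positivity
  have h1 := ((empiricalType_mem_iff hP X hn ω).1 hω).2
  have h2 : (fun x => (counts X n ω x : ℝ) - N x) ∈ tangentSpace h := by
    have := Submodule.sub_mem _ h1 hN
    convert! this using 1
    ext x
    simp
  have h3 : (fun x => (counts X n ω x : ℝ) - N x) =
      (fun x => (counts X n ω x : ℝ)) - fun x => (N x : ℝ) := rfl
  rw [Submodule.mem_inf, and_iff_right h2, LinearMap.mem_ker, sampleMoment_eq, h3, map_sub,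
    sub_eq_zero, smul_right_inj hn0]

/-- Conditional probabilities of sample moments, up to a factor that does not depend on the
moment. -/
theorem condMomentPMF_sub_gaussian_le {μ : Measure Ω} [IsProbabilityMeasure μ] {P Q : 𝒳 → ℝ}
    {X : ℕ → Ω → 𝒳} (hX : ∀ i, Measurable (X i)) (hindep : iIndepFun X μ)
    (hQ : ∀ x, 0 < Q x) (hlaw : ∀ i x, μ.real {ω | X i ω = x} = Q x)
    {d : ℕ} {h : 𝒳 → Fin d → ℝ} {a : Fin d → ℝ}
    (hP : IsInformationProjection Q (constraintSet h a) P) {f : 𝒳 → Fin q → ℝ}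
    (hlattice : SpannedByIntegerVectors (tangentSpace h ⊓ LinearMap.ker (momentMap f))) :
    ∃ I : ℝ, 0 < I ∧ ∃ C : ℝ, 0 ≤ C ∧ ∀ n : ℕ, n ≠ 0 →
      0 < μ.real {ω | empiricalType X n ω ∈ constraintSet h a} → ∃ A : ℝ, 0 < A ∧
      ∀ (N : 𝒳 → ℤ) (m s : EuclideanSpace ℝ 𝒳),
        (fun x => (N x : ℝ) - n * P x) ∈ tangentSpace h → scaledDeviation P n N = m + s →
        s ∈ (tangentSpace h ⊓ LinearMap.ker (momentMap f)).map (whiten P) →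
        m ∈ ((tangentSpace h ⊓ LinearMap.ker (momentMap f)).map (whiten P))ᗮ →
        |condMomentPMF μ X (constraintSet h a) f n ((n : ℝ)⁻¹ • momentMap f fun x => (N x : ℝ)) -
          A * (I * Real.exp (-(‖m‖ ^ 2 / 2)))| ≤ A * (C / √n) := by
  obtain ⟨I, hI, C, hC, H⟩ := countWeight_coset_sum hP.1.1.1 hP.1.1.2 hlattice
    fun v hv => hv.1.1
  refine ⟨I, hI, C, hC, fun n hn hE => ?_⟩
  obtain ⟨K, hK, HK⟩ := exists_measure_coset_eq hX hindep hQ hlaw hP hn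
  set S := tangentSpace h ⊓ LinearMap.ker (momentMap f)
  set Z := μ.real {ω | empiricalType X n ω ∈ constraintSet h a}
  have hn1 : (0 : ℝ) < n := by positivity
  have hZK : 0 < Z⁻¹ * K := by positivity
  -- The factors are the normalization of the conditioning, the constant of the law of counts and
  -- the number of lattice points per unit volume up to a constant; none depends on `N`.
  refine ⟨Z⁻¹ * K * √n ^ finrank ℝ S, by positivity, fun N m s hN hms hs hm => ?_⟩
  have hsum : ∑ x, N x = n := by
    have h1 := hN.1
    rw [Finset.sum_sub_distrib, ← Finset.mul_sum, hP.1.1.2, mul_one, sub_eq_zero] at h1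
    exact_mod_cast h1
  obtain ⟨-, h2⟩ := H n N m s hn hsum hms hs hm
  have h3 := HK S N (fun _ => True) inf_le_left hN
  simp only [and_true, if_true] at h3
  have h4 : {ω | empiricalType X n ω ∈ constraintSet h a ∧
      sampleMoment X f n ω = (n : ℝ)⁻¹ • momentMap f fun x => (N x : ℝ)} =
      {ω | empiricalType X n ω ∈ constraintSet h a ∧
        (fun x => (counts X n ω x : ℝ) - N x) ∈ S} := by
    ext ω
    exact and_congr_right fun hω => sampleMoment_eq_iff hn hP.1 hN hω
  rw [condMomentPMF_eq hX, h4, h3]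
  have h5 := mul_le_mul_of_nonneg_left h2 hZK.le
  rw [← abs_of_pos hZK, ← abs_mul, abs_of_pos hZK, mul_sub] at h5
  convert! h5 using 1
  · congr 1; ring
  · ring

/-- The largest conditional probability of a sample moment. -/
theorem iSup_condMomentPMF_sub_le {μ : Measure Ω} [IsProbabilityMeasure μ] {P Q : 𝒳 → ℝ}
    {X : ℕ → Ω → 𝒳} (hX : ∀ i, Measurable (X i)) {d : ℕ} {h : 𝒳 → Fin d → ℝ} {a : Fin d → ℝ}
    (hP : IsInformationProjection Q (constraintSet h a) P) {f : 𝒳 → Fin q → ℝ}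
    (hlatticeT : SpannedByIntegerVectors (tangentSpace h)) {I C : ℝ} (hI : 0 < I) (hC : 0 ≤ C) :
    ∃ C' : ℝ, 0 ≤ C' ∧ ∀ (n : ℕ) (A : ℝ), n ≠ 0 →
      0 < μ.real {ω | empiricalType X n ω ∈ constraintSet h a} → 0 < A →
      (∀ (N : 𝒳 → ℤ) (m s : EuclideanSpace ℝ 𝒳),
        (fun x => (N x : ℝ) - n * P x) ∈ tangentSpace h → scaledDeviation P n N = m + s →
        s ∈ (tangentSpace h ⊓ LinearMap.ker (momentMap f)).map (whiten P) →
        m ∈ ((tangentSpace h ⊓ LinearMap.ker (momentMap f)).map (whiten P))ᗮ →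
        |condMomentPMF μ X (constraintSet h a) f n ((n : ℝ)⁻¹ • momentMap f fun x => (N x : ℝ)) -
          A * (I * Real.exp (-(‖m‖ ^ 2 / 2)))| ≤ A * (C / √n)) →
      |(⨆ γ, condMomentPMF μ X (constraintSet h a) f n γ) - A * I| ≤ A * (C' / √n) := by
  have hPle : ∀ x, P x ≤ 1 := fun x =>
    hP.1.1.2 ▸ Finset.single_le_sum (fun y _ => (hP.1.1.1 y).le) (Finset.mem_univ x)
  obtain ⟨D, hD, HD⟩ := exists_integerVector_norm_le hP.1.1.1 hPle hlatticeT
  refine ⟨C + I * D ^ 2, by positivity, fun n A hn hE hA H => ?_⟩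
  set S := (tangentSpace h ⊓ LinearMap.ker (momentMap f)).map (whiten P)
  have hn1 : (1 : ℝ) ≤ n := by exact_mod_cast Nat.one_le_iff_ne_zero.2 hn
  have ht : 1 ≤ √(n : ℝ) := Real.one_le_sqrt.2 hn1
  have ht0 : 0 < √(n : ℝ) := one_pos.trans_le ht
  have Hproj := fun (N : 𝒳 → ℤ) (hN : (fun x => (N x : ℝ) - n * P x) ∈ tangentSpace h) =>
    H N (scaledDeviation P n N - S.starProjection (scaledDeviation P n N))
      (S.starProjection (scaledDeviation P n N)) hN (by abel)
      (Submodule.starProjection_apply_mem _ _) (Submodule.sub_starProjection_mem_orthogonal _)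
  have hcount : ∀ ω, empiricalType X n ω ∈ constraintSet h a →
      (fun x => (((counts X n ω x : ℕ) : ℤ) : ℝ) - n * P x) ∈ tangentSpace h := fun ω hω => by
    simpa using ((empiricalType_mem_iff hP.1 X hn ω).1 hω).2
  -- Values that are not attained have probability zero; attained ones come from an actual vector of
  -- counts, and the Gaussian factor is at most one.
  have hupper : ∀ γ, condMomentPMF μ X (constraintSet h a) f n γ ≤ A * (I + C / √n) := by
    intro γ
    rcases Set.eq_empty_or_nonempty {ω | empiricalType X n ω ∈ constraintSet h a ∧
      sampleMoment X f n ω = γ} with hempty | ⟨ω, hω, hγ⟩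
    · rw [condMomentPMF_eq hX, hempty, measureReal_empty, mul_zero]
      positivity
    · have h1 := Hproj (fun x => (counts X n ω x : ℤ)) (hcount ω hω)
      simp only [Int.cast_natCast] at h1
      rw [← sampleMoment_eq, hγ] at h1
      set m := scaledDeviation P n (fun x => (counts X n ω x : ℤ)) -
        S.starProjection (scaledDeviation P n fun x => (counts X n ω x : ℤ))
      have h2 : Real.exp (-(‖m‖ ^ 2 / 2)) ≤ 1 := by
        rw [Real.exp_le_one_iff]; have := sq_nonneg ‖m‖; linarith
      have h3 : A * (I * Real.exp (-(‖m‖ ^ 2 / 2))) ≤ A * (I * 1) := by gcongr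
      linarith [(abs_le.1 h1).2]
  obtain ⟨ω, hω⟩ : {ω | empiricalType X n ω ∈ constraintSet h a}.Nonempty := by
    by_contra hcon
    rw [Set.not_nonempty_iff_eq_empty] at hcon
    rw [hcon, measureReal_empty] at hE
    exact hE.false
  -- An integer tangent vector moves some admissible counts to within bounded distance of `n P`. The
  -- resulting `N` need not have positive entries: the estimate `H` does not ask for it.
  obtain ⟨z, hz, hzD⟩ := HD _ (hcount ω hω)
  set N : 𝒳 → ℤ := (fun x => (counts X n ω x : ℤ)) + z with hNdef
  have hsplit : (fun x => (N x : ℝ) - n * P x) =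
      (fun x => (((counts X n ω x : ℕ) : ℤ) : ℝ) - n * P x) + fun x => (z x : ℝ) := by
    ext x
    simp [hNdef]
    ring
  have hN : (fun x => (N x : ℝ) - n * P x) ∈ tangentSpace h := by
    rw [hsplit]
    exact Submodule.add_mem _ (hcount ω hω) hz
  have hnorm : ‖scaledDeviation P n N‖ ≤ D / √n := by
    rw [scaledDeviation_eq, hsplit, map_add, norm_smul, norm_inv, Real.norm_of_nonneg ht0.le,
      ← div_eq_inv_mul]
    gcongr
  have h1 := Hproj N hN
  set m := scaledDeviation P n N - S.starProjection (scaledDeviation P n N) with hm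
  have hmnorm : ‖m‖ ≤ D / √n := by
    refine le_trans ?_ hnorm
    rw [hm, ← Submodule.starProjection_orthogonal_val]
    exact Submodule.norm_starProjection_apply_le _ _
  have hexp : 1 - D ^ 2 / √n ≤ Real.exp (-(‖m‖ ^ 2 / 2)) := by
    have h2 := Real.add_one_le_exp (-(‖m‖ ^ 2 / 2))
    have h3 : ‖m‖ ^ 2 ≤ (D / √n) ^ 2 := by gcongr
    have h4 : (D / √n) ^ 2 ≤ D ^ 2 / √n := by
      rw [div_pow]
      gcongr
      nlinarith
    have : 0 ≤ D ^ 2 / √n := by positivity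
    linarith
  have hlower : A * (I - (C + I * D ^ 2) / √n) ≤
      condMomentPMF μ X (constraintSet h a) f n ((n : ℝ)⁻¹ • momentMap f fun x => (N x : ℝ)) := by
    have h5 : A * (I * (1 - D ^ 2 / √n)) ≤ A * (I * Real.exp (-(‖m‖ ^ 2 / 2))) := by gcongr
    have h6 : A * (I - (C + I * D ^ 2) / √n) = A * (I * (1 - D ^ 2 / √n)) - A * (C / √n) := by
      ring
    linarith [(abs_le.1 h1).1]
  have hbdd : BddAbove (Set.range fun γ => condMomentPMF μ X (constraintSet h a) f n γ) :=
    ⟨_, Set.forall_mem_range.2 hupper⟩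
  rw [abs_le]
  constructor
  · have := hlower.trans (le_ciSup hbdd _)
    linarith
  · have h7 := ciSup_le hupper
    have h8 : A * (C / √n) ≤ A * ((C + I * D ^ 2) / √n) := by
      have : 0 ≤ I * D ^ 2 := by positivity
      gcongr
      linarith
    linarith

/-- Given the constraint, the scaled deviation of the counts is bounded in probability. -/
theorem condLaw_tail_le {μ : Measure Ω} [IsProbabilityMeasure μ] {P Q : 𝒳 → ℝ}
    {X : ℕ → Ω → 𝒳} (hX : ∀ i, Measurable (X i)) (hindep : iIndepFun X μ)
    (hQ : ∀ x, 0 < Q x) (hlaw : ∀ i x, μ.real {ω | X i ω = x} = Q x)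
    {d : ℕ} {h : 𝒳 → Fin d → ℝ} {a : Fin d → ℝ}
    (hP : IsInformationProjection Q (constraintSet h a) P)
    (hlattice : SpannedByIntegerVectors (tangentSpace h)) {ε : ℝ} (hε : 0 < ε) :
    ∃ K : ℝ, 0 ≤ K ∧ ∃ n₀ : ℕ, ∀ n : ℕ, n ≠ 0 → n₀ ≤ n →
      μ.real {ω | empiricalType X n ω ∈ constraintSet h a ∧
        K < ‖scaledDeviation P n fun x => (counts X n ω x : ℤ)‖} ≤
      ε * μ.real {ω | empiricalType X n ω ∈ constraintSet h a} := by
  classical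
  obtain ⟨I, hI, C, hC, H⟩ := countWeight_coset_sum hP.1.1.1 hP.1.1.2 hlattice fun v hv => hv.1
  obtain ⟨C', hC', c, hc, H'⟩ := countWeight_coset_tail_le hP.1.1.1 hP.1.1.2 hlattice
    fun v hv => hv.1
  -- `I / 2` is the lower bound for the total mass, in units of `√n ^ dim T`, valid once `C / √n ≤ I
  -- / 2`; the threshold for `n` is chosen for this.
  obtain ⟨K, hK, hKε⟩ : ∃ K : ℝ, 0 ≤ K ∧ C' * Real.exp (-(c * K ^ 2)) ≤ ε * (I / 2) := by
    refine ⟨√(C' / (c * (ε * (I / 2)))), Real.sqrt_nonneg _, ?_⟩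
    rw [Real.sq_sqrt (by positivity), Real.exp_neg, ← div_eq_mul_inv, div_le_iff₀ (Real.exp_pos _)]
    have h1 := Real.add_one_le_exp (c * (C' / (c * (ε * (I / 2)))))
    have h2 : C' = ε * (I / 2) * (c * (C' / (c * (ε * (I / 2))))) := by field_simp
    calc C' = ε * (I / 2) * (c * (C' / (c * (ε * (I / 2))))) := h2
      _ ≤ _ := by gcongr; linarith
  refine ⟨K, hK, ⌈(2 * C / I) ^ 2⌉₊, fun n hn hn₀ => ?_⟩
  have hn1 : (1 : ℝ) ≤ n := by exact_mod_cast Nat.one_le_iff_ne_zero.2 hn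
  have ht0 : 0 < √(n : ℝ) := Real.sqrt_pos.2 (by linarith)
  have ht : C / √n ≤ I / 2 := by
    have h1 : 2 * C / I ≤ √n := Real.le_sqrt_of_sq_le ((Nat.le_ceil _).trans (by exact_mod_cast hn₀))
    rw [div_le_iff₀ hI] at h1
    rw [div_le_div_iff₀ ht0 two_pos]
    linarith
  rcases Set.eq_empty_or_nonempty {ω | empiricalType X n ω ∈ constraintSet h a} with hE | ⟨ω, hω⟩
  · have : {ω | empiricalType X n ω ∈ constraintSet h a ∧
        K < ‖scaledDeviation P n fun x => (counts X n ω x : ℤ)‖} = ∅ :=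
      Set.subset_eq_empty (fun ω hω => hω.1) hE
    rw [this, hE, measureReal_empty, mul_zero]
  obtain ⟨κ, hκ, HK⟩ := exists_measure_coset_eq hX hindep hQ hlaw hP hn
  set N : 𝒳 → ℤ := fun x => (counts X n ω x : ℤ) with hNdef
  have hcount : ∀ ω, empiricalType X n ω ∈ constraintSet h a →
      (fun x => (counts X n ω x : ℝ) - n * P x) ∈ tangentSpace h := fun ω hω =>
    ((empiricalType_mem_iff hP.1 X hn ω).1 hω).2
  have hN : (fun x => (N x : ℝ) - n * P x) ∈ tangentSpace h := by
    simpa [hNdef] using hcount ω hω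
  have hsum : ∑ x, N x = n := by
    rw [hNdef, ← Nat.cast_sum, sum_counts]
  have hcoset : ∀ ω, empiricalType X n ω ∈ constraintSet h a →
      (fun x => (counts X n ω x : ℝ) - N x) ∈ tangentSpace h := by
    intro ω' hω'
    have := Submodule.sub_mem _ (hcount ω' hω') hN
    convert! this using 1
    ext x
    simp
  have h1 := HK (tangentSpace h) N (fun _ => True) le_rfl hN
  have h2 := HK (tangentSpace h) N (fun M => K < ‖scaledDeviation P n M‖) le_rfl hN
  have hset1 : {ω | empiricalType X n ω ∈ constraintSet h a ∧
      (fun x => (counts X n ω x : ℝ) - N x) ∈ tangentSpace h ∧ True} =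
      {ω | empiricalType X n ω ∈ constraintSet h a} := by
    ext ω
    exact ⟨fun hω => hω.1, fun hω => ⟨hω, hcoset ω hω, trivial⟩⟩
  have hset2 : {ω | empiricalType X n ω ∈ constraintSet h a ∧
      (fun x => (counts X n ω x : ℝ) - N x) ∈ tangentSpace h ∧
        K < ‖scaledDeviation P n fun x => (counts X n ω x : ℤ)‖} =
      {ω | empiricalType X n ω ∈ constraintSet h a ∧
        K < ‖scaledDeviation P n fun x => (counts X n ω x : ℤ)‖} := by
    ext ω
    exact ⟨fun hω => ⟨hω.1, hω.2.2⟩, fun hω => ⟨hω.1, hcoset ω hω.1, hω.2⟩⟩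
  rw [hset1] at h1
  rw [hset2] at h2
  rw [h1, h2]
  simp only [if_true]
  -- For the full tangent space the deviation has no normal component, so `m = 0` and the Gaussian
  -- factor is one.
  obtain ⟨-, h3⟩ := H n N 0 (scaledDeviation P n N) hn hsum (by simp)
    (by rw [scaledDeviation_eq]; exact Submodule.smul_mem _ _ ⟨_, hN, rfl⟩) (Submodule.zero_mem _)
  have h4 := H' n N K hn hsum hK
  have h5 : √n ^ finrank ℝ (tangentSpace h) * (I / 2) ≤
      ∑' z : integerVectors (tangentSpace h), countWeight P n (N + z) := by
    have h6 := (abs_le.1 h3).1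
    have h7 : √n ^ finrank ℝ (tangentSpace h) * (C / √n) ≤
      √n ^ finrank ℝ (tangentSpace h) * (I / 2) := by gcongr
    simp only [norm_zero, ne_eq, OfNat.ofNat_ne_zero, not_false_eq_true, zero_pow, zero_div,
      neg_zero, Real.exp_zero, mul_one] at h6
    linarith
  calc _ ≤ κ * (√n ^ finrank ℝ (tangentSpace h) * (C' * Real.exp (-(c * K ^ 2)))) := by gcongr
    _ ≤ κ * (√n ^ finrank ℝ (tangentSpace h) * (ε * (I / 2))) := by gcongr
    _ = ε * (κ * (√n ^ finrank ℝ (tangentSpace h) * (I / 2))) := by ring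
    _ ≤ _ := by gcongr

end

/-! ### Assembly of the expansion -/

section

variable {𝒳 : Type*} [Fintype 𝒳] {q : ℕ} [DecidableEq 𝒳] {Ω : Type*} [MeasurableSpace 𝒳]
  [MeasurableSingletonClass 𝒳] [MeasurableSpace Ω]

/-- The expansion of the conditional likelihood, in terms of any quadratic form `W` that is the
quotient of the information metric under the moment map. -/
theorem isBigOInProbability_condLikelihood {μ : Measure Ω} [IsProbabilityMeasure μ] {P Q : 𝒳 → ℝ}
    {X : ℕ → Ω → 𝒳} (hX : ∀ i, Measurable (X i)) (hindep : iIndepFun X μ)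
    (hQ : ∀ x, 0 < Q x) (hlaw : ∀ i x, μ.real {ω | X i ω = x} = Q x)
    {d : ℕ} {h : 𝒳 → Fin d → ℝ} {a : Fin d → ℝ}
    (hP : IsInformationProjection Q (constraintSet h a) P) {f : 𝒳 → Fin q → ℝ}
    (hmoment : momentMap f P = 0)
    (hlattice : SpannedByIntegerVectors (tangentSpace h))
    (hlattice' : SpannedByIntegerVectors (tangentSpace h ⊓ LinearMap.ker (momentMap f)))
    {W : Matrix (Fin q) (Fin q) ℝ}
    (hW : ∀ u : Fin q → ℝ, IsLeast {e : ℝ | ∃ v ∈ tangentSpace h, momentMap f v = u ∧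
      e = ∑ x, v x ^ 2 / P x} (u ⬝ᵥ (W *ᵥ u))) :
    IsBigOInProbability (fun n => condLaw μ X (constraintSet h a) n)
      (fun n ω => -Real.log (condLikelihood μ X (constraintSet h a) f n ω) -
        (n : ℝ) / 2 * (sampleMoment X f n ω ⬝ᵥ (W *ᵥ sampleMoment X f n ω)))
      (fun n => (n : ℝ) ^ (-(1 / 2) : ℝ)) := by
  intro ε hε
  obtain ⟨I, hI, C, hC, H⟩ := condMomentPMF_sub_gaussian_le hX hindep hQ hlaw hP hlattice'
  obtain ⟨C', hC', H'⟩ := iSup_condMomentPMF_sub_le (μ := μ) hX hP (f := f) hlattice hI hC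
  obtain ⟨K, hK, n₁, htail⟩ := condLaw_tail_le hX hindep hQ hlaw hP hlattice hε
  obtain ⟨C'', t₀, hlog⟩ := exists_abs_log_ratio_le hI hC hC' (sq_nonneg K)
  refine ⟨C'', max 1 (max n₁ ⌈t₀ ^ 2⌉₊), fun n hn => ?_⟩
  simp only [max_le_iff] at hn
  have hn0 : n ≠ 0 := by omega
  have hn1 : (1 : ℝ) ≤ n := by exact_mod_cast hn.1
  have hnpos : (0 : ℝ) < n := by linarith
  have ht0 : 0 < √(n : ℝ) := Real.sqrt_pos.2 hnpos
  have ht : t₀ ≤ √(n : ℝ) :=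
    Real.le_sqrt_of_sq_le ((Nat.le_ceil _).trans (by exact_mod_cast hn.2.2))
  have hrate : (n : ℝ) ^ (-(1 / 2) : ℝ) = (√n)⁻¹ := by
    rw [Real.rpow_neg hnpos.le, Real.sqrt_eq_rpow]
  set E := {ω | empiricalType X n ω ∈ constraintSet h a} with hEdef
  have hEmeas : MeasurableSet E := measurableSet_empiricalType_mem hX n _
  -- For `n` with a null constraint event the conditional law is the zero measure and the bound is
  -- trivial, so restricting to the remaining `n` needs no separate treatment.
  rcases eq_or_ne (μ E) 0 with hE | hE
  · simp [condLaw, ← hEdef, cond_eq_zero_of_meas_eq_zero hE]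
  have hEreal : 0 < μ.real E := ENNReal.toReal_pos hE (measure_ne_top _ _)
  obtain ⟨A, hA, HA⟩ := H n hn0 hEreal
  have hsup := H' n A hn0 hEreal hA HA
  have hdiv : ∀ {x y c : ℝ}, |x - A * y| ≤ A * c → |x / A - y| ≤ c := fun {x y c} hxy => by
    have h1 : x / A - y = (x - A * y) / A := by field_simp
    rw [h1, abs_div, abs_of_pos hA, div_le_iff₀ hA]
    linarith
  have hgood : ∀ ω ∈ E, ‖scaledDeviation P n fun x => (counts X n ω x : ℤ)‖ ≤ K →
      |-Real.log (condLikelihood μ X (constraintSet h a) f n ω) -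
        (n : ℝ) / 2 * (sampleMoment X f n ω ⬝ᵥ (W *ᵥ sampleMoment X f n ω))| ≤
          C'' * (n : ℝ) ^ (-(1 / 2) : ℝ) := by
    intro ω hω hωK
    set N : 𝒳 → ℤ := fun x => (counts X n ω x : ℤ) with hNdef
    have hN : (fun x => (N x : ℝ) - n * P x) ∈ tangentSpace h := by
      simpa [hNdef] using ((empiricalType_mem_iff hP.1 X hn0 ω).1 hω).2
    set S := (tangentSpace h ⊓ LinearMap.ker (momentMap f)).map (whiten P)
    set s := S.starProjection (scaledDeviation P n N) with hs
    set m := scaledDeviation P n N - s with hm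
    have hms : scaledDeviation P n N = m + s := by rw [hm]; abel
    have hsS : s ∈ S := Submodule.starProjection_apply_mem _ _
    have hmS : m ∈ Sᗮ := Submodule.sub_starProjection_mem_orthogonal _
    have hmK : ‖m‖ ^ 2 ≤ K ^ 2 := by
      have h1 : ‖m‖ ≤ ‖scaledDeviation P n N‖ := by
        rw [hm, hs, ← Submodule.starProjection_orthogonal_val]
        exact Submodule.norm_starProjection_apply_le _ _
      have h2 := h1.trans hωK
      gcongr
    have hsm : sampleMoment X f n ω = (n : ℝ)⁻¹ • momentMap f fun x => (N x : ℝ) := by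
      rw [sampleMoment_eq]
      simp [hNdef]
    have hquad : ‖m‖ ^ 2 = n * (sampleMoment X f n ω ⬝ᵥ (W *ᵥ sampleMoment X f n ω)) := by
      -- Both sides are the least element of the same set of energies, so no formula for `W` is
      -- needed.
      have h1 := (isLeast_norm_sq_of_orthogonal hP.1.1.1 hmoment hN hms hsS hmS).unique (hW _)
      have h2 : (√n)⁻¹ • momentMap f (fun x => (N x : ℝ)) = √n • sampleMoment X f n ω := by
        rw [hsm, smul_smul]
        congr 1
        rw [← div_eq_mul_inv, Real.sqrt_div_self']
        simp
      rw [h1, h2, Matrix.mulVec_smul, dotProduct_smul, smul_dotProduct, smul_eq_mul, smul_eq_mul,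
        ← mul_assoc, Real.mul_self_sqrt hnpos.le]
    have hpmf := HA N m s hN hms hsS hmS
    rw [← hsm] at hpmf
    -- Numerator and supremum are both divided by `A`, which then cancels in the likelihood ratio.
    have h3 := hlog (√n) _ _ (‖m‖ ^ 2) ht0 ht hmK (hdiv hpmf) (hdiv hsup)
    rw [div_div_div_cancel_right₀ hA.ne'] at h3
    rw [hrate, ← div_eq_mul_inv, condLikelihood]
    rw [hquad] at h3
    convert! h3 using 3
    ring
  have hbad : (condLaw μ X (constraintSet h a) n) {ω | C'' * (n : ℝ) ^ (-(1 / 2) : ℝ) <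
      |-Real.log (condLikelihood μ X (constraintSet h a) f n ω) -
        (n : ℝ) / 2 * (sampleMoment X f n ω ⬝ᵥ (W *ᵥ sampleMoment X f n ω))|} ≤
      (μ E)⁻¹ * μ {ω | empiricalType X n ω ∈ constraintSet h a ∧
        K < ‖scaledDeviation P n fun x => (counts X n ω x : ℤ)‖} := by
    rw [condLaw, cond_apply hEmeas]
    gcongr
    rintro ω ⟨hω, hωbad⟩
    refine ⟨hω, ?_⟩
    by_contra hcon
    exact absurd (hgood ω hω (not_lt.1 hcon)) (not_le.2 hωbad)
  refine hbad.trans ?_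
  have h4 := htail n hn0 hn.2.1
  rw [mul_comm, ← div_eq_mul_inv]
  refine ENNReal.div_le_of_le_mul ?_
  rw [← ofReal_measureReal (μ := μ) (s := E), ← ofReal_measureReal, ← ENNReal.ofReal_mul hε.le]
  exact ENNReal.ofReal_le_ofReal h4

end

end ConstrainedGMM

end

theorem mainTheorem5
    {𝒳 : Type*} [Fintype 𝒳] [DecidableEq 𝒳] [MeasurableSpace 𝒳] [MeasurableSingletonClass 𝒳]
    {Ω : Type*} [MeasurableSpace Ω] (μ : Measure Ω) [IsProbabilityMeasure μ]
    -- independent draws from a reference distribution of full support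
    (Q : 𝒳 → ℝ) (hQ : ∀ x, 0 < Q x)
    (X : ℕ → Ω → 𝒳) (hX : ∀ i, Measurable (X i)) (hindep : iIndepFun X μ)
    (hlaw : ∀ i x, μ.real {ω | X i ω = x} = Q x)
    -- constraints `E_P[h(X)] = α(θ)`, moment function `g(x, θ)`, information projections `P*_θ`
    {Θ : Type*} {d q r : ℕ} (h : 𝒳 → Fin d → ℝ) (α : Θ → Fin d → ℝ)
    (g : 𝒳 → Θ → Fin q → ℝ) (Pstar : Θ → 𝒳 → ℝ)
    (hproj : ∀ θ, ConstrainedGMM.IsInformationProjection Q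
      (ConstrainedGMM.constraintSet h (α θ)) (Pstar θ))
    -- the moment condition holds at the projection
    (hmoment : ∀ θ, ConstrainedGMM.momentMap (fun x => g x θ) (Pstar θ) = 0)
    -- the moment map restricted to the tangent space has full rank
    (hrank : ∀ θ, (ConstrainedGMM.tangentSpace h).map
      (ConstrainedGMM.momentMap fun x => g x θ) = ⊤)
    -- lattice conditions
    (hlattice : ConstrainedGMM.SpannedByIntegerVectors (ConstrainedGMM.tangentSpace h))
    (hlattice' : ∀ θ, ConstrainedGMM.SpannedByIntegerVectors
      (ConstrainedGMM.tangentSpace h ⊓ LinearMap.ker (ConstrainedGMM.momentMap fun x => g x θ)))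
    -- an orthonormal basis of the tangent space
    (V : Matrix 𝒳 (Fin r) ℝ)
    (hV : ConstrainedGMM.IsOrthonormalBasisOf V (ConstrainedGMM.tangentSpace h)) :
    ∀ θ : Θ,
      -- both matrices that are inverted are positive definite
      (ConstrainedGMM.projectedHessian V (Pstar θ)).PosDef ∧
      (ConstrainedGMM.pushforwardMetric (fun x => g x θ) V (Pstar θ)).PosDef ∧
      -- the weight is the metric induced on moment space by the information metric
      (∀ u : Fin q → ℝ, IsLeast
        {e : ℝ | ∃ v ∈ ConstrainedGMM.tangentSpace h,
          ConstrainedGMM.momentMap (fun x => g x θ) v = u ∧ e = ∑ x, v x ^ 2 / Pstar θ x}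
        (u ⬝ᵥ (ConstrainedGMM.optimalWeight (fun x => g x θ) V (Pstar θ) *ᵥ u))) ∧
      -- the second-order expansion of the conditional negative log-likelihood
      ConstrainedGMM.IsBigOInProbability
        (fun n => ConstrainedGMM.condLaw μ X (ConstrainedGMM.constraintSet h (α θ)) n)
        (fun n ω =>
          -Real.log (ConstrainedGMM.condLikelihood μ X (ConstrainedGMM.constraintSet h (α θ))
              (fun x => g x θ) n ω)
            - (n : ℝ) / 2 *
              (ConstrainedGMM.sampleMoment X (fun x => g x θ) n ω ⬝ᵥ
                (ConstrainedGMM.optimalWeight (fun x => g x θ) V (Pstar θ) *ᵥ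
                  ConstrainedGMM.sampleMoment X (fun x => g x θ) n ω)))
        (fun n => (n : ℝ) ^ (-(1 / 2) : ℝ)) := by
  intro θ
  have hpos := (hproj θ).1.1.1
  have hleast := ConstrainedGMM.isLeast_optimalWeight hV hpos (hrank θ)
  exact ⟨ConstrainedGMM.posDef_projectedHessian hV hpos,
    ConstrainedGMM.posDef_pushforwardMetric hV hpos (hrank θ), hleast,
    ConstrainedGMM.isBigOInProbability_condLikelihood hX hindep hQ hlaw (hproj θ) (hmoment θ)
      hlattice (hlattice' θ) hleast⟩
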